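/- \textbf{Setting.} Let $\mathcal M_{1/2}^1$ be the set of all metrics $f$ on $\mathbb N$ with values in $\{0\}\cup[\tfrac12,1]$, with the Borel structure inherited from $\mathbb R^{\mathbb N\times\mathbb N}$. Let $V$ be the $\mathbb Q$-vector space of finitely supported rational sequences, and let $\mathcal B\subseteq\mathbb R^V$ be the set of all norms $\nu$ on $V$ whose canonical extension to the real space $c_{00}$ of finitely supported real sequences is still a norm, with the Borel structure inherited from $\mathbb R^V$. A norm $\nu\in\mathcal B$ is a code of the infinite-dimensional separable real Banach space $X_\nu$, the completion of $c_{00}$ under the extension of $\nu$. For $f,g\in\mathcal M_{1/2}^1$ let $\rho_{GH}(f,g)$ be the Gromov--Hausdorff distance of $(\mathbb N,f)$ and $(\mathbb N,g)$, i.e. the infimum of the Hausdorff distances of isometric copies of the two spaces in a common metric space. For a map $T$ between metric spaces let $\operatorname{Lip}(T)\in[0,\infty]$ be its least Lipschitz constant. The Lipschitz distance of metric spaces $M,N$ is $\inf\log\max\{\operatorname{Lip}(T),\operatorname{Lip}(T^{-1})\}$ over all bi-Lipschitz bijections $T:M\to N$. For $\mu,\nu\in\mathcal B$, write $X=X_\mu$,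 $Y=X_\nu$, and let $B_X,B_Y$ be the closed unit balls. Define (with $\inf\emptyset=\infty$): \begin{itemize} \item $\rho_K(\mu,\nu)$ (Kadets distance): the infimum of the Hausdorff distances of $i(B_X)$ and $j(B_Y)$ in $Z$ over all Banach spaces $Z$ and linear isometric embeddings $i:X\to Z$, $j:Y\to Z$; \item $\rho_{BM}(\mu,\nu)=\inf\log(\|T\|\,\|T^{-1}\|)$ over all linear isomorphisms $T$ of $X$ onto $Y$ (Banach--Mazur distance); \item $\rho_L(\mu,\nu)$: the Lipschitz distance of $X$ and $Y$; \item $\rho_U(\mu,\nu)=\inf\log\big((\operatorname{Lip}_\infty u)(\operatorname{Lip}_\infty u^{-1})\big)$ over all uniform homeomorphisms $u$ of $X$ onto $Y$, where $\operatorname{Lip}_\infty u=\inf_{\eta>0}\sup\{\|u(x)-u(y)\|/\|x-y\|:\|x-y\|\ge\eta\}$ (uniform distance); \item $\rho_N(\mu,\nu)$ (net distance): the infimum of the Lipschitz distances of $A$ and $B$ over all nets $A\subseteq X$, $B\subseteq Y$, where a subset $A$ of a metric space is a net if there are $a,b>0$ such that distinct points of $A$ have distance at least $a$ and every point of the space has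 distance less than $b$ from some point of $A$; \item $\rho_{GH}^{\mathcal B}(\mu,\nu)$: the Gromov--Hausdorff distance of $B_X$ and $B_Y$. \end{itemize} Let $\rho_1$ and $\rho_2$ be $[0,\infty]$-valued pseudometrics on $P$ and $Q$. A Borel map $F:P\to Q$ is a \emph{Borel-uniformly continuous reduction} of $\rho_1$ to $\rho_2$ if for every $\varepsilon>0$ there are $\delta_1,\delta_2>0$ such that, for all $x,y\in P$, $\rho_1(x,y)<\delta_1$ implies $\rho_2(F(x),F(y))<\varepsilon$, and $\rho_2(F(x),F(y))<\delta_2$ implies $\rho_1(x,y)<\varepsilon$. It is a \emph{Borel-Lipschitz reduction} if there is $C>0$ such that $\rho_2(F(x),F(y))\le C\rho_1(x,y)$ and $\rho_1(x,y)\le C\rho_2(F(x),F(y))$ for all $x,y\in P$. \textbf{Theorem.} Let $\alpha,\delta$ be real numbers with $1<\alpha<\alpha+\delta\le\frac{200}{199}$. For $f\in\mathcal M_{1/2}^1$ and $x=(x_n)\in\ell_2$ (real scalars) put $$\|x\|_f=\sup\Big(\{\|x\|_{\ell_2}\}\cup\Big\{\tfrac1{\sqrt2}\,\big(\alpha+\delta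 f(n,m)\big)\,|x_n+x_m| : n\ne m\Big\}\Big).$$ Then $\|x\|_{\ell_2}\le\|x\|_f\le\frac{200}{199}\|x\|_{\ell_2}$ for all $f\in\mathcal M_{1/2}^1$ and $x\in\ell_2$, and there is a map $\Phi:\mathcal M_{1/2}^1\to\mathcal B$ such that for every $f$ the code $\Phi(f)$ is the restriction of $\|\cdot\|_f$ to $V$ and $X_{\Phi(f)}$ is linearly isometric to $(\ell_2,\|\cdot\|_f)$. The map $\Phi$ is injective and Borel; it is a Borel-uniformly continuous reduction of $\rho_{GH}$ on $\mathcal M_{1/2}^1$ to each of $\rho_K,\rho_{BM},\rho_L,\rho_U,\rho_N,\rho_{GH}^{\mathcal B}$ on $\mathcal B$; and it is a Borel-Lipschitz reduction of $\rho_{GH}$ to $\rho_K$ and to $\rho_{BM}$. -/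

import Mathlib

open Set
open scoped ENNReal

noncomputable section

/-! ### Codes of metric spaces -/

/-- The space of all metrics on `ℕ`, inside the product of countably many copies of `ℝ`. Its
measurable structure is induced by the product `σ`-algebra, i.e. it is the Borel one. -/
def metricCodes : Set (ℕ → ℕ → ℝ) :=
  {f | (∀ n m, f n m = 0 ↔ n = m) ∧ (∀ n m, f n m = f m n) ∧
    (∀ n m k, f n k ≤ f n m + f m k)}

/-- The metrics on `ℕ` with values in `{0} ∪ [p, q]`. -/
def boundedMetricCodes (p q : ℝ) : Set (ℕ → ℕ → ℝ) :=
  {f | f ∈ metricCodes ∧ ∀ n m, f n m = 0 ∨ f n m ∈ Icc p q}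

/-- The set `ℕ`, to be equipped with the metric `f`. -/
def CodedMetricSpace (_f : metricCodes) : Type := ℕ

instance (f : metricCodes) : MetricSpace (CodedMetricSpace f) where
  dist n m := f.1 n m
  dist_self n := (f.2.1 n n).2 rfl
  dist_comm n m := f.2.2.1 n m
  dist_triangle n m k := f.2.2.2 n m k
  eq_of_dist_eq_zero {n m} h := (f.2.1 n m).1 h

/-! ### Codes of Banach spaces -/

/-- The inclusion of the finitely supported rational sequences into the real ones. -/
def ratToReal (v : ℕ →₀ ℚ) : ℕ →₀ ℝ := v.mapRange (fun q : ℚ => (q : ℝ)) Rat.cast_zero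

/-- `N` is a norm on the space `c₀₀` of finitely supported real sequences that extends the
function `ν` given on the finitely supported rational sequences. -/
def IsNormExtension (ν : (ℕ →₀ ℚ) → ℝ) (N : Seminorm ℝ (ℕ →₀ ℝ)) : Prop :=
  (∀ x, N x = 0 → x = 0) ∧ ∀ v, N (ratToReal v) = ν v

/-- The codes of infinite-dimensional separable Banach spaces: the norms on the `ℚ`-vector space
of finitely supported rational sequences whose extension to `c₀₀` is a norm as well. The
measurable structure is induced by the product `σ`-algebra; there are countably many factors, so
it is the Borel one. -/
def banachCodes : Set ((ℕ →₀ ℚ) → ℝ) :=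
  {ν | (∀ v, ν v = 0 ↔ v = 0) ∧ (∀ (q : ℚ) v, ν (q • v) = |(q : ℝ)| * ν v) ∧
    (∀ v w, ν (v + w) ≤ ν v + ν w) ∧ ∃ N, IsNormExtension ν N}

/-- The extension to `c₀₀` is unique. -/
theorem IsNormExtension.unique {ν : (ℕ →₀ ℚ) → ℝ} {N N' : Seminorm ℝ (ℕ →₀ ℝ)}
    (h : IsNormExtension ν N) (h' : IsNormExtension ν N') : N = N' := by
  have key : ∀ (M : Seminorm ℝ (ℕ →₀ ℝ)) (x : ℕ →₀ ℝ) (s : Finset ℕ) (ε : ℝ),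
      x.support ⊆ s → (∀ i ∈ s, |x i| ≤ ε) →
      M x ≤ ε * ∑ i ∈ s, M (Finsupp.single i 1) := by
    intro M x s ε hs hε
    have hx : x = ∑ i ∈ s, x i • Finsupp.single i (1 : ℝ) := by
      conv_lhs => rw [← Finsupp.sum_single x]
      rw [Finsupp.sum_of_support_subset x hs _ (by simp)]
      simp
    calc M x = M (∑ i ∈ s, x i • Finsupp.single i (1 : ℝ)) := by rw [← hx]
      _ ≤ ∑ i ∈ s, M (x i • Finsupp.single i (1 : ℝ)) := by
          refine Finset.le_sum_of_subadditive M (map_zero M).le (map_add_le_add M) _ _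
      _ ≤ ∑ i ∈ s, ε * M (Finsupp.single i (1 : ℝ)) := by
          refine Finset.sum_le_sum fun i hi => ?_
          rw [map_smul_eq_mul, Real.norm_eq_abs]
          exact mul_le_mul_of_nonneg_right (hε i hi) (apply_nonneg M _)
      _ = _ := by rw [Finset.mul_sum]
  ext x
  set K : ℝ := ∑ i ∈ x.support, N (Finsupp.single i 1) +
    ∑ i ∈ x.support, N' (Finsupp.single i 1)
  have hK : 0 ≤ K := add_nonneg (Finset.sum_nonneg fun _ _ => apply_nonneg N _)
    (Finset.sum_nonneg fun _ _ => apply_nonneg N' _)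
  have main : ∀ ε : ℝ, 0 < ε → |N x - N' x| ≤ ε * K := by
    intro ε hε
    have hq : ∀ i, ∃ q : ℚ, |x i - q| < ε := fun i => exists_rat_near (x i) hε
    choose q hq using hq
    set v : ℕ →₀ ℚ := Finsupp.onFinset x.support (fun i => if i ∈ x.support then q i else 0)
      (by intro i hi; by_contra hc; simp [hc] at hi) with hv
    have hvx : ∀ i ∈ x.support, |(x - ratToReal v) i| ≤ ε := by
      intro i hi
      have : (ratToReal v) i = (q i : ℝ) := by
        simp [ratToReal, hv, Finsupp.mem_support_iff.1 hi]
      rw [Finsupp.sub_apply, this]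
      exact (hq i).le
    have hsupp : (x - ratToReal v).support ⊆ x.support := by
      intro i hi
      by_contra hc
      have h0 : x i = 0 := Finsupp.notMem_support_iff.1 hc
      have : (x - ratToReal v) i = 0 := by simp [ratToReal, hv, h0]
      exact (Finsupp.mem_support_iff.1 hi) this
    have h1 := key N _ _ ε hsupp hvx
    have h2 := key N' _ _ ε hsupp hvx
    have a1 := abs_sub_map_le_sub N x (ratToReal v)
    have a2 := abs_sub_map_le_sub N' x (ratToReal v)
    rw [h.2] at a1
    rw [h'.2] at a2
    rw [abs_le] at *
    constructor <;> simp only [K] <;> nlinarith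
  have h0 : |N x - N' x| ≤ 0 := by
    refine le_of_forall_pos_le_add fun e he => ?_
    have := main (e / (K + 1)) (by positivity)
    have h3 : e / (K + 1) * K ≤ e := by
      rw [div_mul_eq_mul_div, div_le_iff₀ (by positivity)]
      nlinarith
    linarith
  exact sub_eq_zero.1 (abs_nonpos_iff.1 h0)

/-- The unique extension of the norm `ν` to `c₀₀`. -/
def extendedNorm (ν : banachCodes) : Seminorm ℝ (ℕ →₀ ℝ) := ν.2.2.2.2.choose

theorem extendedNorm_spec (ν : banachCodes) : IsNormExtension ν.1 (extendedNorm ν) :=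
  ν.2.2.2.2.choose_spec

/-- The space `c₀₀`, to be equipped with the extension of the norm `ν`. -/
def CodedNormedSpace (_ν : banachCodes) : Type := ℕ →₀ ℝ

instance (ν : banachCodes) : AddCommGroup (CodedNormedSpace ν) :=
  inferInstanceAs (AddCommGroup (ℕ →₀ ℝ))

instance (ν : banachCodes) : Module ℝ (CodedNormedSpace ν) :=
  inferInstanceAs (Module ℝ (ℕ →₀ ℝ))

instance (ν : banachCodes) : NormedAddCommGroup (CodedNormedSpace ν) :=
  AddGroupNorm.toNormedAddCommGroup
    { toFun := fun x => extendedNorm ν x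
      map_zero' := map_zero (extendedNorm ν)
      add_le' := map_add_le_add (extendedNorm ν)
      neg' := map_neg_eq_map (extendedNorm ν)
      eq_zero_of_map_eq_zero' := (extendedNorm_spec ν).1 }

instance (ν : banachCodes) : NormedSpace ℝ (CodedNormedSpace ν) where
  norm_smul_le a x := (map_smul_eq_mul (extendedNorm ν) a x).le

/-- The real Banach space coded by `ν`. -/
abbrev CodedBanachSpace (ν : banachCodes) : Type :=
  UniformSpace.Completion (CodedNormedSpace ν)

/-! ### Distances between metric spaces and between Banach spaces -/

/-- Logarithm with values in `[0, ∞]`. It is only applied to quantities that are at least `1` for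
the spaces in question, so the truncation at `0` has no effect. -/
def elog (x : ℝ≥0∞) : ℝ≥0∞ := (ENNReal.log x).toENNReal

/-- The Gromov-Hausdorff distance of two arbitrary metric spaces. -/
def ghDistance (M N : Type) [MetricSpace M] [MetricSpace N] : ℝ≥0∞ :=
  ⨅ (Z : Type) (_ : MetricSpace Z) (i : M → Z) (_ : Isometry i) (j : N → Z) (_ : Isometry j),
    Metric.hausdorffEDist (range i) (range j)

/-- The least Lipschitz constant of `T` (or `∞`). -/
def lipNorm {M N : Type} [MetricSpace M] [MetricSpace N] (T : M → N) : ℝ≥0∞ :=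
  ⨆ (m : M) (n : M) (_ : m ≠ n), edist (T m) (T n) / edist m n

/-- The Lipschitz distance of two metric spaces. -/
def lipschitzDistance (M N : Type) [MetricSpace M] [MetricSpace N] : ℝ≥0∞ :=
  ⨅ (T : M ≃ N) (_ : lipNorm T < ∞) (_ : lipNorm T.symm < ∞),
    elog (max (lipNorm T) (lipNorm T.symm))

/-- `A` is an `(a, b)`-net for some positive reals `a` and `b`. -/
def IsNet {M : Type} [MetricSpace M] (A : Set M) : Prop :=
  ∃ a > (0 : ℝ), ∃ b > (0 : ℝ),
    (∀ m ∈ A, ∀ n ∈ A, m ≠ n → a ≤ dist m n) ∧ ∀ x : M, ∃ n ∈ A, dist x n < b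

/-- The Lipschitz constant of `u` for large distances. -/
def lipInfty {M N : Type} [MetricSpace M] [MetricSpace N] (u : M → N) : ℝ≥0∞ :=
  ⨅ (η : ℝ) (_ : 0 < η), ⨆ (x : M) (y : M) (_ : η ≤ dist x y), edist (u x) (u y) / edist x y

section Banach

variable (X Y : Type) [NormedAddCommGroup X] [NormedSpace ℝ X]
  [NormedAddCommGroup Y] [NormedSpace ℝ Y]

/-- The Kadets distance. -/
def kadetsDistance : ℝ≥0∞ :=
  ⨅ (Z : Type) (_ : NormedAddCommGroup Z) (_ : NormedSpace ℝ Z) (_ : CompleteSpace Z)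
    (i : X →ₗᵢ[ℝ] Z) (j : Y →ₗᵢ[ℝ] Z),
    Metric.hausdorffEDist (i '' Metric.closedBall 0 1) (j '' Metric.closedBall 0 1)

/-- The (logarithmic) Banach-Mazur distance. -/
def banachMazurDistance : ℝ≥0∞ :=
  ⨅ T : X ≃L[ℝ] Y,
    ENNReal.ofReal (Real.log (‖(T : X →L[ℝ] Y)‖ * ‖(T.symm : Y →L[ℝ] X)‖))

/-- The uniform distance. -/
def uniformDistance : ℝ≥0∞ :=
  ⨅ u : X ≃ᵤ Y, elog (lipInfty u * lipInfty u.symm)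

/-- The net distance. -/
def netDistance : ℝ≥0∞ :=
  ⨅ (A : Set X) (_ : IsNet A) (B : Set Y) (_ : IsNet B), lipschitzDistance A B

/-- The Gromov-Hausdorff distance of Banach spaces, i.e. that of their closed unit balls. -/
def ghBallDistance : ℝ≥0∞ :=
  ghDistance (Metric.closedBall (0 : X) 1) (Metric.closedBall (0 : Y) 1)

end Banach

/-! ### The distances on codes -/

/-- `ρ_GH` on the metrics on `ℕ` with values in `{0} ∪ [p, q]`. -/
def rhoGH (p q : ℝ) (f g : boundedMetricCodes p q) : ℝ≥0∞ :=
  ghDistance (CodedMetricSpace ⟨f.1, f.2.1⟩) (CodedMetricSpace ⟨g.1, g.2.1⟩)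

def rhoK (μ ν : banachCodes) : ℝ≥0∞ :=
  kadetsDistance (CodedBanachSpace μ) (CodedBanachSpace ν)

def rhoBM (μ ν : banachCodes) : ℝ≥0∞ :=
  banachMazurDistance (CodedBanachSpace μ) (CodedBanachSpace ν)

def rhoL (μ ν : banachCodes) : ℝ≥0∞ :=
  lipschitzDistance (CodedBanachSpace μ) (CodedBanachSpace ν)

def rhoU (μ ν : banachCodes) : ℝ≥0∞ :=
  uniformDistance (CodedBanachSpace μ) (CodedBanachSpace ν)

def rhoN (μ ν : banachCodes) : ℝ≥0∞ :=
  netDistance (CodedBanachSpace μ) (CodedBanachSpace ν)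

def rhoGHB (μ ν : banachCodes) : ℝ≥0∞ :=
  ghBallDistance (CodedBanachSpace μ) (CodedBanachSpace ν)

/-! ### Reductions -/

section Reductions

variable {P Q : Type} [MeasurableSpace P] [MeasurableSpace Q]

/-- `F` is a Borel-uniformly continuous reduction from `ρP` to `ρQ`. -/
def IsBorelUniformReduction (ρP : P → P → ℝ≥0∞) (ρQ : Q → Q → ℝ≥0∞) (F : P → Q) : Prop :=
  Measurable F ∧ ∀ ε : ℝ, 0 < ε → ∃ δP > (0 : ℝ), ∃ δQ > (0 : ℝ),
    (∀ x y, ρP x y < ENNReal.ofReal δP → ρQ (F x) (F y) < ENNReal.ofReal ε) ∧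
    (∀ x y, ρQ (F x) (F y) < ENNReal.ofReal δQ → ρP x y < ENNReal.ofReal ε)

/-- `F` is a Borel-Lipschitz reduction from `ρP` to `ρQ`. -/
def IsBorelLipschitzReduction (ρP : P → P → ℝ≥0∞) (ρQ : Q → Q → ℝ≥0∞) (F : P → Q) : Prop :=
  Measurable F ∧ ∃ C > (0 : ℝ), ∀ x y,
    ρQ (F x) (F y) ≤ ENNReal.ofReal C * ρP x y ∧ ρP x y ≤ ENNReal.ofReal C * ρQ (F x) (F y)

end Reductions

/-! ### The renorming of the Hilbert space -/

/-- The real Hilbert space `ℓ₂` of square-summable sequences. -/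
abbrev Ell2 : Type := lp (fun _ : ℕ => ℝ) 2

/-- A finitely supported rational sequence, as an element of `ℓ₂`. -/
def toEll2 (v : ℕ →₀ ℚ) : Ell2 :=
  ⟨fun n => (v n : ℝ), by
    refine (memℓp_zero (v.hasFiniteSupport.subset ?_)).of_exponent_ge zero_le
    intro n hn
    simpa using hn⟩

/-- The norm `‖x‖_f`, the supremum of `‖x‖` and of all numbers
`(1 / √2) (α + δ f(n, m)) |xₙ + xₘ|` with `n ≠ m`. -/
def renorm (α δ : ℝ) (f : ℕ → ℕ → ℝ) (x : Ell2) : ℝ :=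
  sSup ({‖x‖} ∪ {r | ∃ n m : ℕ, n ≠ m ∧ r = 1 / √2 * (α + δ * f n m) * |x n + x m|})

end

/-!
The renormed space is a Hilbert space whose dual unit ball carries spikes along the axes
`(eₙ + eₘ) / √2`; the length of a spike is the weight `α + δ f(n, m)`. The whole theorem rests on
the rigidity of this picture: a near-isometry between the unit balls of two such spaces, linear or
not, nearly matches the weights up to a permutation of the coordinates
(`IsNearIsometry.exists_perm`).

The reason is as follows. The spikes are felt only on vectors within a small angle of an axis, and
elsewhere the norm is the Hilbert norm. Take the two points `± axis n m / 2` as opposite vertices of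
a square whose sides, and whose other diagonal, avoid all spikes. The images of the sides are not
longer than the sides, up to `ε`. If the image of the other diagonal avoids the spikes as well, then
this image is not shorter than the diagonal, and by the inequality between the diagonals and the
sides of a quadrilateral the images of `± axis n m / 2` have Hilbert distance at most `1 + O(ε)`.
Their distance in the renormed space is still about the weight `c n m`, so their difference points
along an axis of at least this weight (`IsNearIsometry.exists_axis`). A suitable other diagonal
exists (`IsNearIsometry.exists_indVec`): two of them can be chosen with an inner product that is
nearly preserved but is far from the inner products of any two axes.

This sends pairs of natural numbers to pairs. Inner products are preserved up to a small relative
error, because all norms involved are within one half percent of the Hilbert norm; hence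
intersecting pairs go to intersecting pairs, and the map is induced by a permutation of `ℕ`
(`exists_perm_of_card_inter`). All estimates are linear in `ε`.

Each of the six distances produces such near-isometries: the Kadets distance dominates the
Gromov–Hausdorff distance of the balls, and in the other cases the additive errors of a coarse
equivalence disappear under rescaling (`IsCoarseEquiv.exists_isNearIsometry`). In the opposite
direction, metrics with values in `{0} ∪ [1/2, 1]` that are close in the Gromov–Hausdorff distance
nearly agree up to a permutation, and permuting the coordinates of `ℓ₂` then gives a linear
isomorphism with constants close to `1`. For the Kadets distance the spaces are embedded into
`ℓ₂ × ℓ_∞` by listing the values of the norming functionals (`spikeEmbedding`).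
-/

noncomputable section

/-! ### Indicator vectors in `ℓ₂` -/

/-- The indicator function of a finite set, as an element of `ℓ₂`. -/
def indVec (s : Finset ℕ) : Ell2 := ∑ i ∈ s, lp.single 2 i (1 : ℝ)

theorem indVec_apply (s : Finset ℕ) (j : ℕ) : indVec s j = if j ∈ s then 1 else 0 := by
  rw [indVec, lp.coeFn_sum, Finset.sum_apply]
  simp [Pi.single_apply]

theorem inner_indVec_left (s : Finset ℕ) (x : Ell2) : inner ℝ (indVec s) x = ∑ i ∈ s, x i := by
  simp [indVec, sum_inner, lp.inner_single_left]

theorem inner_indVec_indVec (s t : Finset ℕ) :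
    inner ℝ (indVec s) (indVec t) = ((s ∩ t).card : ℝ) := by
  rw [inner_indVec_left]
  simp [indVec_apply]

/-- The unit vector `(eₙ + eₘ) / √2` for `n ≠ m`. -/
def axis (n m : ℕ) : Ell2 := (1 / √2) • indVec {n, m}

theorem axis_apply (n m i : ℕ) : axis n m i = 1 / √2 * if i = n ∨ i = m then 1 else 0 := by
  simp [axis, indVec_apply]

theorem one_div_sqrt_two_mul_self : 1 / √2 * (1 / √2) = 1 / 2 := by
  rw [div_mul_div_comm, Real.mul_self_sqrt (by norm_num)]; norm_num

theorem inner_axis_right {n m : ℕ} (h : n ≠ m) (x : Ell2) :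
    inner ℝ x (axis n m) = 1 / √2 * (x n + x m) := by
  rw [axis, inner_smul_right, real_inner_comm, inner_indVec_left, Finset.sum_pair h]

theorem inner_axis_axis (n m k l : ℕ) :
    inner ℝ (axis n m) (axis k l) = ((({n, m} ∩ {k, l} : Finset ℕ).card : ℝ)) / 2 := by
  rw [axis, axis, inner_smul_right, real_inner_smul_left, inner_indVec_indVec, ← mul_assoc,
    one_div_sqrt_two_mul_self]
  ring

theorem norm_axis {n m : ℕ} (h : n ≠ m) : ‖axis n m‖ = 1 := by
  have : ‖axis n m‖ ^ 2 = 1 := by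
    rw [← real_inner_self_eq_norm_sq, inner_axis_axis]
    simp [Finset.card_pair h]
  nlinarith [norm_nonneg (axis n m)]

theorem abs_inner_axis_le {n m : ℕ} (h : n ≠ m) (x : Ell2) : |inner ℝ x (axis n m)| ≤ ‖x‖ := by
  simpa [norm_axis h] using abs_real_inner_le_norm x (axis n m)

/-! ### Norms with spikes -/

/-- The norm on `ℓ₂` whose dual unit ball is spanned by the dual Hilbert ball together with the
spikes `± c n m • axis n m`. -/
def spikeNorm (c : ℕ → ℕ → ℝ) (x : Ell2) : ℝ :=
  sSup ({‖x‖} ∪ {r | ∃ n m : ℕ, n ≠ m ∧ r = 1 / √2 * c n m * |x n + x m|})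

/-- The weights `c` are symmetric with values in `[κ, 200 / 199]` off the diagonal, where
`κ > 1`. -/
structure IsSpikeWeight (κ : ℝ) (c : ℕ → ℕ → ℝ) : Prop where
  one_lt : 1 < κ
  symm : ∀ n m, c n m = c m n
  le : ∀ n m, n ≠ m → κ ≤ c n m
  le_max : ∀ n m, n ≠ m → c n m ≤ 200 / 199

namespace IsSpikeWeight

variable {κ : ℝ} {c : ℕ → ℕ → ℝ}

theorem pos (hc : IsSpikeWeight κ c) {n m : ℕ} (h : n ≠ m) : 0 < c n m := by
  linarith [hc.le n m h, hc.one_lt]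

theorem bddAbove (hc : IsSpikeWeight κ c) (x : Ell2) :
    BddAbove ({‖x‖} ∪ {r | ∃ n m : ℕ, n ≠ m ∧ r = 1 / √2 * c n m * |x n + x m|}) := by
  refine ⟨200 / 199 * ‖x‖, ?_⟩
  rintro r (rfl | ⟨n, m, h, rfl⟩)
  · linarith [norm_nonneg x]
  · have h1 := abs_inner_axis_le h x
    rw [inner_axis_right h, abs_mul, abs_of_pos (by positivity)] at h1
    have h2 := hc.le_max n m h
    have h3 := hc.pos h
    calc 1 / √2 * c n m * |x n + x m| = c n m * (1 / √2 * |x n + x m|) := by ring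
      _ ≤ _ := by gcongr

theorem norm_le (hc : IsSpikeWeight κ c) (x : Ell2) : ‖x‖ ≤ spikeNorm c x :=
  le_csSup (hc.bddAbove x) (Or.inl rfl)

theorem inner_le (hc : IsSpikeWeight κ c) {n m : ℕ} (h : n ≠ m) (x : Ell2) :
    c n m * |inner ℝ x (axis n m)| ≤ spikeNorm c x := by
  refine le_csSup (hc.bddAbove x) (Or.inr ⟨n, m, h, ?_⟩)
  rw [inner_axis_right h, abs_mul, abs_of_pos (by positivity : (0 : ℝ) < 1 / √2)]
  ring

theorem spikeNorm_le_iff (hc : IsSpikeWeight κ c) {x : Ell2} {B : ℝ} : spikeNorm c x ≤ B ↔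
    ‖x‖ ≤ B ∧ ∀ n m, n ≠ m → c n m * |inner ℝ x (axis n m)| ≤ B := by
  refine ⟨fun h => ⟨(hc.norm_le x).trans h, fun n m hn => (hc.inner_le hn x).trans h⟩,
    fun h => csSup_le ⟨_, Or.inl rfl⟩ ?_⟩
  rintro r (rfl | ⟨n, m, hn, rfl⟩)
  · exact h.1
  · have := h.2 n m hn
    rw [inner_axis_right hn, abs_mul, abs_of_pos (by positivity : (0 : ℝ) < 1 / √2)] at this
    linarith

theorem spikeNorm_le (hc : IsSpikeWeight κ c) (x : Ell2) : spikeNorm c x ≤ 200 / 199 * ‖x‖ := by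
  rw [hc.spikeNorm_le_iff]
  refine ⟨by linarith [norm_nonneg x], fun n m h => ?_⟩
  have := hc.le_max n m h
  gcongr
  exact abs_inner_axis_le h x

theorem exists_of_lt (hc : IsSpikeWeight κ c) {x : Ell2} {B : ℝ} (hB : ‖x‖ ≤ B)
    (h : B < spikeNorm c x) : ∃ n m, n ≠ m ∧ B < c n m * |inner ℝ x (axis n m)| := by
  by_contra! hcon
  exact absurd (hc.spikeNorm_le_iff.2 ⟨hB, hcon⟩) (not_le.2 h)

theorem spikeNorm_add_le (hc : IsSpikeWeight κ c) (x y : Ell2) :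
    spikeNorm c (x + y) ≤ spikeNorm c x + spikeNorm c y := by
  rw [hc.spikeNorm_le_iff]
  refine ⟨(norm_add_le x y).trans (add_le_add (hc.norm_le x) (hc.norm_le y)), fun n m h => ?_⟩
  have hp := hc.pos h
  calc c n m * |inner ℝ (x + y) (axis n m)|
      ≤ c n m * (|inner ℝ x (axis n m)| + |inner ℝ y (axis n m)|) := by
        rw [inner_add_left]; gcongr; exact abs_add_le _ _
    _ ≤ _ := by
        rw [mul_add]; exact add_le_add (hc.inner_le h x) (hc.inner_le h y)

theorem spikeNorm_smul_le (hc : IsSpikeWeight κ c) (a : ℝ) (x : Ell2) :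
    spikeNorm c (a • x) ≤ |a| * spikeNorm c x := by
  rw [hc.spikeNorm_le_iff]
  refine ⟨?_, fun n m h => ?_⟩
  · rw [norm_smul, Real.norm_eq_abs]
    gcongr
    exact hc.norm_le x
  · rw [real_inner_smul_left, abs_mul, mul_left_comm]
    gcongr
    exact hc.inner_le h x

theorem spikeNorm_smul (hc : IsSpikeWeight κ c) (a : ℝ) (x : Ell2) :
    spikeNorm c (a • x) = |a| * spikeNorm c x := by
  refine le_antisymm (hc.spikeNorm_smul_le a x) ?_
  rcases eq_or_ne a 0 with rfl | ha
  · simpa using hc.norm_le (0 : Ell2)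
  · have h := hc.spikeNorm_smul_le a⁻¹ (a • x)
    rw [smul_smul, inv_mul_cancel₀ ha, one_smul, abs_inv] at h
    have hp : 0 < |a| := abs_pos.2 ha
    calc |a| * spikeNorm c x ≤ |a| * (|a|⁻¹ * spikeNorm c (a • x)) := by gcongr
      _ = _ := by field_simp

/-- On vectors without large coordinates the spikes are not felt: each spike evaluates to at most
`√2 * (200 / 199) * M`, and `√2 * (200 / 199) < 3 / 2`. -/
theorem spikeNorm_eq_norm (hc : IsSpikeWeight κ c) {x : Ell2} {M : ℝ}
    (hM : ∀ i, |x i| ≤ M) (hx : 3 / 2 * M ≤ ‖x‖) : spikeNorm c x = ‖x‖ := by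
  refine le_antisymm (hc.spikeNorm_le_iff.2 ⟨le_rfl, fun n m h => ?_⟩) (hc.norm_le x)
  have h0 : 0 ≤ M := (abs_nonneg _).trans (hM 0)
  have h2 := hc.le_max n m h
  rw [inner_axis_right h, abs_mul, abs_of_pos (by positivity : (0 : ℝ) < 1 / √2)]
  have h3 : |x n + x m| ≤ 2 * M := (abs_add_le _ _).trans (by linarith [hM n, hM m])
  have h4 : 1 / √2 * |x n + x m| ≤ 199 / 200 * ‖x‖ := by
    rw [div_mul_eq_mul_div, one_mul, div_le_iff₀ (by positivity)]
    have : (1.41 : ℝ) ≤ √2 := Real.le_sqrt_of_sq_le (by norm_num)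
    nlinarith
  calc c n m * (1 / √2 * |x n + x m|) ≤ 200 / 199 * (199 / 200 * ‖x‖) :=
        mul_le_mul h2 h4 (by positivity) (by norm_num)
    _ = ‖x‖ := by ring

end IsSpikeWeight

/-! ### Near-isometries between unit balls -/

/-- `R` is a correspondence between sets lying between the balls of radii `1` and `11 / 10` for the
norms `N` and `N'`; it distorts distances by at most `ε`. -/
structure IsNearIsometry {E F : Type} [AddCommGroup E] [AddCommGroup F] (N : E → ℝ) (N' : F → ℝ)
    (ε : ℝ) (R : E → F → Prop) : Prop where
  exists_right : ∀ x, N x ≤ 1 → ∃ y, R x y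
  exists_left : ∀ y, N' y ≤ 1 → ∃ x, R x y
  left_le : ∀ x y, R x y → N x ≤ 11 / 10
  right_le : ∀ x y, R x y → N' y ≤ 11 / 10
  abs_sub_le : ∀ x y x' y', R x y → R x' y' → |N (x - x') - N' (y - y')| ≤ ε

theorem IsNearIsometry.symm {E F : Type} [AddCommGroup E] [AddCommGroup F] {N : E → ℝ}
    {N' : F → ℝ} {ε : ℝ} {R : E → F → Prop} (h : IsNearIsometry N N' ε R) :
    IsNearIsometry N' N ε (fun y x => R x y) where
  exists_right := h.exists_left
  exists_left := h.exists_right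
  left_le y x := h.right_le x y
  right_le y x := h.left_le x y
  abs_sub_le y x y' x' hx hx' := by rw [abs_sub_comm]; exact h.abs_sub_le x y x' y' hx hx'

/-! ### Hilbert space geometry -/

theorem inner_sub_sub_eq (a b c d : Ell2) : inner ℝ (a - b) (c - d) =
    (‖a - d‖ ^ 2 + ‖b - c‖ ^ 2 - ‖a - c‖ ^ 2 - ‖b - d‖ ^ 2) / 2 := by
  simp only [norm_sub_sq_real, inner_sub_left, inner_sub_right]
  ring

/-- In a Hilbert space the squares of the diagonals of a quadrilateral do not exceed the squares of
the sides. -/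
theorem quadrilateral_le (a b p q : Ell2) : ‖a - b‖ ^ 2 + ‖p - q‖ ^ 2 ≤
    ‖a - p‖ ^ 2 + ‖a - q‖ ^ 2 + ‖b - p‖ ^ 2 + ‖b - q‖ ^ 2 := by
  have h : 0 ≤ ‖(a + b) - (p + q)‖ ^ 2 := by positivity
  simp only [norm_sub_sq_real, norm_add_sq_real, inner_add_left, inner_add_right] at h ⊢
  linarith

/-- A vector of norm about `1` on which a spike is felt is close to this spike. -/
theorem exists_norm_sub_axis_le {k l : ℕ} (h : k ≠ l) {y : Ell2} (h1 : ‖y‖ ≤ 1.001)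
    (h2 : 0.99 ≤ ‖y‖) (h3 : 199 / 200 * ‖y‖ ≤ |inner ℝ y (axis k l)|) :
    ∃ t : ℝ, |t| = 1 ∧ ‖y - t • axis k l‖ ≤ 0.1005 := by
  have key : ∀ t : ℝ, |t| = 1 → 199 / 200 * ‖y‖ ≤ t * inner ℝ y (axis k l) →
      ‖y - t • axis k l‖ ≤ 0.1005 := by
    intro t ht hy
    have h4 : ‖y - t • axis k l‖ ^ 2 ≤ 0.0101 := by
      rw [norm_sub_sq_real, norm_smul, norm_axis h, inner_smul_right, Real.norm_eq_abs, ht]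
      nlinarith
    exact le_of_sq_le_sq (h4.trans (by norm_num)) (by norm_num)
  rcases abs_cases (inner ℝ y (axis k l)) with ⟨h4, -⟩ | ⟨h4, -⟩
  · exact ⟨1, by simp, key 1 (by simp) (by linarith)⟩
  · exact ⟨-1, by simp, key (-1) (by simp) (by linarith)⟩

theorem abs_inner_sub_inner_le {y₁ y₂ s₁ s₂ : Ell2} (hs₁ : ‖s₁‖ = 1) (hy₂ : ‖y₂‖ ≤ 1.001)
    (h₁ : ‖y₁ - s₁‖ ≤ 0.1005) (h₂ : ‖y₂ - s₂‖ ≤ 0.1005) :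
    |inner ℝ y₁ y₂ - inner ℝ s₁ s₂| ≤ 0.2012 := by
  have e : inner ℝ y₁ y₂ - inner ℝ s₁ s₂ = inner ℝ (y₁ - s₁) y₂ + inner ℝ s₁ (y₂ - s₂) := by
    rw [inner_sub_left, inner_sub_right]; ring
  rw [e]
  have a1 := abs_real_inner_le_norm (y₁ - s₁) y₂
  have a2 := abs_real_inner_le_norm s₁ (y₂ - s₂)
  have a3 : ‖y₁ - s₁‖ * ‖y₂‖ ≤ 0.1005 * 1.001 := mul_le_mul h₁ hy₂ (norm_nonneg _) (by norm_num)
  rw [hs₁, one_mul] at a2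
  exact (abs_add_le _ _).trans (by linarith)

/-- Up to signs, inner products of axes are half-integers. -/
theorem exists_inner_smul_axis {t₁ t₂ : ℝ} (h₁ : |t₁| = 1) (h₂ : |t₂| = 1) (n m k l : ℕ) :
    ∃ z : ℤ, inner ℝ (t₁ • axis n m) (t₂ • axis k l) = (z : ℝ) / 2 ∧
      |z| = (({n, m} ∩ {k, l} : Finset ℕ).card : ℤ) := by
  rw [real_inner_smul_left, inner_smul_right, inner_axis_axis]
  rcases eq_or_eq_neg_of_abs_eq h₁ with rfl | rfl <;>
    rcases eq_or_eq_neg_of_abs_eq h₂ with rfl | rfl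
  · exact ⟨(({n, m} ∩ {k, l} : Finset ℕ).card : ℤ), by push_cast; ring, by simp⟩
  · exact ⟨-(({n, m} ∩ {k, l} : Finset ℕ).card : ℤ), by push_cast; ring, by simp⟩
  · exact ⟨-(({n, m} ∩ {k, l} : Finset ℕ).card : ℤ), by push_cast; ring, by simp⟩
  · exact ⟨(({n, m} ∩ {k, l} : Finset ℕ).card : ℤ), by push_cast; ring, by simp⟩

theorem norm_smul_axis_of_abs_eq_one {t : ℝ} (ht : |t| = 1) {k l : ℕ} (h : k ≠ l) :
    ‖t • axis k l‖ = 1 := by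
  rw [norm_smul, norm_axis h, Real.norm_eq_abs, ht, one_mul]

theorem norm_indVec_of_card_eq_four {s : Finset ℕ} (hs : s.card = 4) : ‖indVec s‖ = 2 := by
  have : ‖indVec s‖ ^ 2 = 4 := by
    rw [← real_inner_self_eq_norm_sq, inner_indVec_indVec]
    simp [hs]
  nlinarith [norm_nonneg (indVec s)]

theorem IsSpikeWeight.spikeNorm_half_indVec {κ : ℝ} {c : ℕ → ℕ → ℝ} (hc : IsSpikeWeight κ c)
    {s : Finset ℕ} (hs : s.card = 4) : spikeNorm c ((1 / 2 : ℝ) • indVec s) = 1 := by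
  have hn : ‖(1 / 2 : ℝ) • indVec s‖ = 1 := by
    rw [norm_smul, norm_indVec_of_card_eq_four hs]; norm_num
  refine Eq.trans ?_ hn
  refine hc.spikeNorm_eq_norm (M := 1 / 2) (fun i => ?_) (by rw [hn]; norm_num)
  rw [lp.coeFn_smul, Pi.smul_apply, indVec_apply]
  split_ifs <;> norm_num

/-- The square with diagonal from `-axis n m / 2` to `axis n m / 2` and with the other diagonal
spread over four far coordinates has sides on which the spikes are not felt. -/
theorem IsSpikeWeight.spikeNorm_side {κ : ℝ} {c : ℕ → ℕ → ℝ} (hc : IsSpikeWeight κ c)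
    {s : Finset ℕ} (hs : s.card = 4) {n m : ℕ} (h : n ≠ m) (hns : n ∉ s) (hms : m ∉ s)
    {a b : ℝ} (ha : |a| = 1 / 2) (hb : |b| = 1 / 4) :
    spikeNorm c (a • axis n m - b • indVec s) = √(1 / 2) := by
  have h0 : inner ℝ (axis n m) (indVec s) = 0 := by
    rw [real_inner_comm, inner_axis_right h, indVec_apply, indVec_apply, if_neg hns, if_neg hms]
    simp
  have hn : ‖a • axis n m - b • indVec s‖ = √(1 / 2) := by
    rw [eq_comm, Real.sqrt_eq_iff_eq_sq (by norm_num) (norm_nonneg _), norm_sub_sq_real, norm_smul,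
      norm_smul, real_inner_smul_left, inner_smul_right, h0, norm_axis h,
      norm_indVec_of_card_eq_four hs, Real.norm_eq_abs, Real.norm_eq_abs, ha, hb]
    norm_num
  have hsq : 1 / √2 = √(1 / 2) := by rw [Real.sqrt_div' _ (by norm_num)]; simp
  have hlb : (0.7 : ℝ) ≤ √(1 / 2) := Real.le_sqrt_of_sq_le (by norm_num)
  refine Eq.trans ?_ hn
  refine hc.spikeNorm_eq_norm (M := 1 / 2 * √(1 / 2)) (fun i => ?_) (by rw [hn]; linarith)
  rw [lp.coeFn_sub, Pi.sub_apply, lp.coeFn_smul, Pi.smul_apply, lp.coeFn_smul, Pi.smul_apply,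
    indVec_apply, axis_apply, hsq, smul_eq_mul, smul_eq_mul]
  by_cases hi : i = n ∨ i = m
  · have his : i ∉ s := by rcases hi with rfl | rfl <;> assumption
    rw [if_pos hi, if_neg his, mul_one, mul_zero, sub_zero, abs_mul, ha,
      abs_of_nonneg (Real.sqrt_nonneg _)]
  · rw [if_neg hi, mul_zero, mul_zero, zero_sub, abs_neg, abs_mul, hb]
    split_ifs <;> linarith

/-! ### Near-isometries between spiked norms -/

namespace IsNearIsometry

variable {κ ε : ℝ} {c c' : ℕ → ℕ → ℝ} {R : Ell2 → Ell2 → Prop}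

theorem spikeNorm_sub_le (hR : IsNearIsometry (spikeNorm c) (spikeNorm c') ε R) {x y x' y' : Ell2}
    (h : R x y) (h' : R x' y') : spikeNorm c' (y - y') ≤ spikeNorm c (x - x') + ε := by
  linarith [abs_le.1 (hR.abs_sub_le x y x' y' h h')]

theorem norm_sub_le (hR : IsNearIsometry (spikeNorm c) (spikeNorm c') ε R)
    (hc : IsSpikeWeight κ c) (hc' : IsSpikeWeight κ c') {x y x' y' : Ell2}
    (h : R x y) (h' : R x' y') : ‖y - y'‖ ≤ 200 / 199 * ‖x - x'‖ + ε := by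
  linarith [hR.spikeNorm_sub_le h h', hc'.norm_le (y - y'), hc.spikeNorm_le (x - x')]

theorem nonneg (hR : IsNearIsometry (spikeNorm c) (spikeNorm c') ε R)
    (hc : IsSpikeWeight κ c) : 0 ≤ ε := by
  have h0 : spikeNorm c 0 ≤ 1 := by simpa using (hc.spikeNorm_le 0).trans (by simp)
  obtain ⟨y, hy⟩ := hR.exists_right 0 h0
  exact (abs_nonneg _).trans (hR.abs_sub_le _ _ _ _ hy hy)

/-- Squared Hilbert distances are nearly preserved, because the spiked norms exceed the Hilbert norm
by at most the factor `200 / 199`, whose square is less than `1.0102`. -/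
theorem abs_norm_sq_sub_le (hR : IsNearIsometry (spikeNorm c) (spikeNorm c') ε R)
    (hc : IsSpikeWeight κ c) (hc' : IsSpikeWeight κ c') (hε : ε ≤ 0.0001) {x y x' y' : Ell2}
    (h : R x y) (h' : R x' y') {M : ℝ} (hM : 1 ≤ M) (hx : ‖x - x'‖ ≤ M) :
    |‖x - x'‖ ^ 2 - ‖y - y'‖ ^ 2| ≤ 0.0104 * M ^ 2 := by
  have h1 := hR.norm_sub_le hc hc' h h'
  have h2 := hR.symm.norm_sub_le hc' hc h h'
  have h0 := hR.nonneg hc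
  set d := ‖x - x'‖
  set d' := ‖y - y'‖
  have hd : 0 ≤ d := norm_nonneg _
  have hd' : 0 ≤ d' := norm_nonneg _
  have hd1 : d' ≤ d + 0.00515 * M := by linarith
  have hd2 : d - 0.0051 * M ≤ d' := by linarith
  rw [abs_le]
  constructor
  · have : d' ^ 2 ≤ (d + 0.00515 * M) ^ 2 := by gcongr
    nlinarith
  · nlinarith

/-- Inner products of differences are nearly preserved. -/
theorem abs_inner_sub_le (hR : IsNearIsometry (spikeNorm c) (spikeNorm c') ε R)
    (hc : IsSpikeWeight κ c) (hc' : IsSpikeWeight κ c') (hε : ε ≤ 0.0001)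
    {x₁ y₁ x₂ y₂ x₃ y₃ x₄ y₄ : Ell2} (h₁ : R x₁ y₁) (h₂ : R x₂ y₂) (h₃ : R x₃ y₃) (h₄ : R x₄ y₄)
    {M : ℝ} (hM : 1 ≤ M) (hx₁ : ‖x₁‖ ≤ M / 2) (hx₂ : ‖x₂‖ ≤ M / 2) (hx₃ : ‖x₃‖ ≤ M / 2)
    (hx₄ : ‖x₄‖ ≤ M / 2) :
    |inner ℝ (x₁ - x₂) (x₃ - x₄) - inner ℝ (y₁ - y₂) (y₃ - y₄)| ≤ 0.0208 * M ^ 2 := by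
  have key : ∀ {x y x' y'}, R x y → R x' y' → ‖x‖ ≤ M / 2 → ‖x'‖ ≤ M / 2 →
      |‖x - x'‖ ^ 2 - ‖y - y'‖ ^ 2| ≤ 0.0104 * M ^ 2 := fun h h' hx hx' =>
    hR.abs_norm_sq_sub_le hc hc' hε h h' hM ((_root_.norm_sub_le _ _).trans (by linarith))
  have a := abs_le.1 (key h₁ h₄ hx₁ hx₄)
  have b := abs_le.1 (key h₂ h₃ hx₂ hx₃)
  have c := abs_le.1 (key h₁ h₃ hx₁ hx₃)
  have d := abs_le.1 (key h₂ h₄ hx₂ hx₄)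
  rw [inner_sub_sub_eq, inner_sub_sub_eq, abs_le]
  constructor <;> linarith

/-- For some four-element set `s` of far coordinates, the images of the points `± indVec s / 4`
differ by a vector on which the spikes are not felt. Otherwise two such differences, for sets `s`
that meet in one point, would both be close to axes; but their inner product is about `1 / 4`,
which is not a half-integer. -/
theorem exists_indVec (hR : IsNearIsometry (spikeNorm c) (spikeNorm c') ε R)
    (hc : IsSpikeWeight κ c) (hc' : IsSpikeWeight κ c') (hε : ε ≤ 0.0001) (N : ℕ) :
    ∃ s : Finset ℕ, s.card = 4 ∧ (∀ i ∈ s, N ≤ i) ∧ ∃ p q, R ((1 / 4 : ℝ) • indVec s) p ∧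
      R ((-(1 / 4) : ℝ) • indVec s) q ∧ spikeNorm c' (p - q) = ‖p - q‖ := by
  have h0 := hR.nonneg hc
  have hnorm : ∀ s : Finset ℕ, s.card = 4 → ∀ b : ℝ, |b| = 1 / 4 → ‖b • indVec s‖ = 1 / 2 := by
    intro s hs b hb
    rw [norm_smul, norm_indVec_of_card_eq_four hs, Real.norm_eq_abs, hb]; norm_num
  have hex : ∀ s : Finset ℕ, s.card = 4 → ∀ b : ℝ, |b| = 1 / 4 → ∃ p, R (b • indVec s) p :=
    fun s hs b hb => hR.exists_right _ ((hc.spikeNorm_le _).trans (by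
      rw [hnorm s hs b hb]; norm_num))
  have hsub : ∀ s : Finset ℕ, (1 / 4 : ℝ) • indVec s - (-(1 / 4) : ℝ) • indVec s =
      (1 / 2 : ℝ) • indVec s := by
    intro s; rw [← sub_smul]; norm_num
  have b1 : |(1 / 4 : ℝ)| = 1 / 4 := by norm_num [abs_of_pos]
  have b2 : |(-(1 / 4) : ℝ)| = 1 / 4 := by rw [abs_neg, b1]
  by_contra! hcon
  have hbad : ∀ s : Finset ℕ, s.card = 4 → (∀ i ∈ s, N ≤ i) → ∃ p q,
      R ((1 / 4 : ℝ) • indVec s) p ∧ R ((-(1 / 4) : ℝ) • indVec s) q ∧ ‖p - q‖ ≤ 1.001 ∧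
      ∃ t : ℝ, |t| = 1 ∧ ∃ k l, k ≠ l ∧ ‖(p - q) - t • axis k l‖ ≤ 0.1005 := by
    intro s hs hN
    obtain ⟨p, hp⟩ := hex s hs _ b1
    obtain ⟨q, hq⟩ := hex s hs _ b2
    have hne := hcon s hs hN p q hp hq
    have hlt : ‖p - q‖ < spikeNorm c' (p - q) := lt_of_le_of_ne (hc'.norm_le _) (Ne.symm hne)
    obtain ⟨k, l, hkl, hin⟩ := hc'.exists_of_lt le_rfl hlt
    have h1 := hR.spikeNorm_sub_le hp hq
    have h2 := hR.symm.spikeNorm_sub_le hp hq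
    rw [hsub, hc.spikeNorm_half_indVec hs] at h1 h2
    have h3 := hc'.spikeNorm_le (p - q)
    have h4 : 199 / 200 * ‖p - q‖ ≤ |inner ℝ (p - q) (axis k l)| := by
      have h5 := hc'.le_max k l hkl
      have h6 : c' k l * |inner ℝ (p - q) (axis k l)| ≤
          200 / 199 * |inner ℝ (p - q) (axis k l)| := by gcongr
      linarith
    have h7 : ‖p - q‖ ≤ 1.001 := by linarith
    obtain ⟨t, ht, htn⟩ := exists_norm_sub_axis_le hkl h7 (by linarith) h4
    exact ⟨p, q, hp, hq, h7, t, ht, k, l, hkl, htn⟩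
  set s : Finset ℕ := {N, N + 1, N + 2, N + 3} with hs
  set s' : Finset ℕ := {N, N + 4, N + 5, N + 6} with hs'
  have hsc : s.card = 4 := by rw [hs]; simp
  have hsc' : s'.card = 4 := by rw [hs']; simp
  have hss : (s ∩ s').card = 1 := by
    have : s ∩ s' = {N} := by
      ext i; simp only [hs, hs', Finset.mem_inter, Finset.mem_insert, Finset.mem_singleton]; omega
    rw [this, Finset.card_singleton]
  obtain ⟨p, q, hp, hq, hpq, t, ht, k, l, hkl, hpa⟩ := hbad s hsc
    (by intro i; simp only [hs, Finset.mem_insert, Finset.mem_singleton]; omega)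
  obtain ⟨p', q', hp', hq', hpq', t', ht', k', l', hkl', hpa'⟩ := hbad s' hsc'
    (by intro i; simp only [hs', Finset.mem_insert, Finset.mem_singleton]; omega)
  have e1 := hR.abs_inner_sub_le hc hc' hε hp hq hp' hq' le_rfl (hnorm _ hsc _ b1).le
    (hnorm _ hsc _ b2).le (hnorm _ hsc' _ b1).le (hnorm _ hsc' _ b2).le
  rw [hsub, hsub, real_inner_smul_left, inner_smul_right, inner_indVec_indVec, hss] at e1
  have e2 := abs_inner_sub_inner_le (norm_smul_axis_of_abs_eq_one ht hkl) hpq' hpa hpa'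
  obtain ⟨z, hz, -⟩ := exists_inner_smul_axis ht ht' k l k' l'
  rw [hz] at e2
  -- `z / 2` differs from `1 / 4` by at most `0.0208 + 0.2012 < 1 / 4`.
  rw [abs_le] at e1 e2
  have z1 : (0 : ℝ) < z := by push_cast at e1; linarith
  have z2 : (z : ℝ) < 1 := by push_cast at e1; linarith
  have z3 : 0 < z := by exact_mod_cast z1
  have z4 : z < 1 := by exact_mod_cast z2
  omega

/-- The key step: the images of `± axis n m / 2` differ by a vector whose Hilbert norm is at most
`1 + O(ε)`, by the quadrilateral inequality. As the spiked norm has to be nearly preserved, this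
vector is close to an axis whose weight is at least `c n m - O(ε)`. -/
theorem exists_axis (hR : IsNearIsometry (spikeNorm c) (spikeNorm c') ε R)
    (hc : IsSpikeWeight κ c) (hc' : IsSpikeWeight κ c') (hε0 : 0 < ε)
    (hεκ : ε ≤ (κ - 1) / 100)
    {n m : ℕ} (h : n ≠ m) {a b : Ell2}
    (ha : R ((1 / 2 : ℝ) • axis n m) a) (hb : R ((-(1 / 2) : ℝ) • axis n m) b) :
    ‖a - b‖ ≤ 1.001 ∧ ∃ k l, k ≠ l ∧ c n m - 8 * ε ≤ c' k l ∧
      ∃ t : ℝ, |t| = 1 ∧ ‖(a - b) - t • axis k l‖ ≤ 0.1005 := by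
  have hκ : κ ≤ 200 / 199 := (hc.le n m h).trans (hc.le_max n m h)
  have hε : ε ≤ 0.0001 := by linarith
  obtain ⟨s, hs, hN, p, q, hp, hq, hpq⟩ := hR.exists_indVec hc hc' hε (n + m + 1)
  have hns : n ∉ s := fun hn => by have := hN n hn; omega
  have hms : m ∉ s := fun hn => by have := hN m hn; omega
  have a1 : |(1 / 2 : ℝ)| = 1 / 2 := by norm_num [abs_of_pos]
  have a2 : |(-(1 / 2) : ℝ)| = 1 / 2 := by rw [abs_neg, a1]
  have b1 : |(1 / 4 : ℝ)| = 1 / 4 := by norm_num [abs_of_pos]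
  have b2 : |(-(1 / 4) : ℝ)| = 1 / 4 := by rw [abs_neg, b1]
  have side : ∀ {r d : ℝ} {x y : Ell2}, |r| = 1 / 2 → |d| = 1 / 4 → R (r • axis n m) x →
      R (d • indVec s) y → ‖x - y‖ ^ 2 ≤ (√(1 / 2) + ε) ^ 2 := by
    intro r d x y hr hd hx hy
    have h1 := hR.spikeNorm_sub_le hx hy
    rw [hc.spikeNorm_side hs h hns hms hr hd] at h1
    have h2 := (hc'.norm_le _).trans h1
    gcongr
  have hquad := quadrilateral_le a b p q
  have s1 := side a1 b1 ha hp
  have s2 := side a1 b2 ha hq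
  have s3 := side a2 b1 hb hp
  have s4 := side a2 b2 hb hq
  have hdiag : 1 - ε ≤ ‖p - q‖ := by
    have h1 := hR.symm.spikeNorm_sub_le hp hq
    rw [← sub_smul, hpq] at h1
    norm_num only at h1
    rw [hc.spikeNorm_half_indVec hs] at h1
    linarith
  have hsq : √(1 / 2) ^ 2 = (1 / 2 : ℝ) := Real.sq_sqrt (by norm_num)
  have hsq' : √(1 / 2) ≤ (0.7072 : ℝ) := Real.sqrt_le_iff.2 (by norm_num)
  have hu : ‖a - b‖ ≤ 1 + 5 * ε := by
    have h1 : (1 - ε) ^ 2 ≤ ‖p - q‖ ^ 2 := by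
      have : 0 ≤ 1 - ε := by linarith
      gcongr
    have h2 : ‖a - b‖ ^ 2 ≤ (1 + 5 * ε) ^ 2 := by
      have h3 : √(1 / 2) * ε ≤ 0.7072 * ε := by gcongr
      have h4 : (√(1 / 2) + ε) ^ 2 = 1 / 2 + 2 * (√(1 / 2) * ε) + ε ^ 2 := by
        rw [add_sq, hsq]; ring
      have h5 : 0 ≤ ε ^ 2 := sq_nonneg ε
      rw [h4] at s1 s2 s3 s4
      linarith
    exact le_of_sq_le_sq h2 (by linarith)
  have hu' : c n m - ε ≤ spikeNorm c' (a - b) := by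
    have h1 := hR.symm.spikeNorm_sub_le ha hb
    rw [← sub_smul] at h1
    norm_num only at h1
    rw [one_smul] at h1
    have h2 := hc.inner_le h (axis n m)
    rw [real_inner_self_eq_norm_sq, norm_axis h] at h2
    norm_num at h2
    linarith
  have hcl := hc.le n m h
  have hone := hc.one_lt
  obtain ⟨k, l, hkl, hin⟩ : ∃ k l, k ≠ l ∧
      c n m - 2 * ε ≤ c' k l * |inner ℝ (a - b) (axis k l)| := by
    obtain ⟨k, l, hkl, hin⟩ := hc'.exists_of_lt (x := a - b) (B := c n m - 2 * ε)
      (by linarith) (by linarith)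
    exact ⟨k, l, hkl, hin.le⟩
  have hcm := hc'.le_max k l hkl
  have hcp := hc'.pos hkl
  have hin' := abs_inner_axis_le hkl (a - b)
  refine ⟨by linarith, k, l, hkl, ?_, ?_⟩
  · have : c' k l * |inner ℝ (a - b) (axis k l)| ≤ c' k l * (1 + 5 * ε) := by
      gcongr; linarith
    have : c' k l * ε ≤ 200 / 199 * ε := by gcongr
    linarith
  · have h5 : c' k l * |inner ℝ (a - b) (axis k l)| ≤
        200 / 199 * |inner ℝ (a - b) (axis k l)| := by gcongr
    exact exists_norm_sub_axis_le hkl (by linarith) (by linarith) (by linarith)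

end IsNearIsometry

/-! ### Maps of two-element sets that preserve intersections -/

theorem Finset.eq_of_card_inter_eq_two {s t : Finset ℕ} (hs : s.card = 2) (ht : t.card = 2)
    (h : (s ∩ t).card = 2) : s = t := by
  have h1 : s ∩ t = s := Finset.eq_of_subset_of_card_le Finset.inter_subset_left (by omega)
  have h2 : s ∩ t = t := Finset.eq_of_subset_of_card_le Finset.inter_subset_right (by omega)
  rw [← h1, h2]

/-- If four two-element sets meet pairwise in one point, then they have a point in common: only
three of them could form a triangle. -/
theorem mem_of_card_inter_eq_one {T : Fin 4 → Finset ℕ} (hT : ∀ i, (T i).card = 2)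
    (hi : ∀ i j, i ≠ j → (T i ∩ T j).card = 1) {a : ℕ} (h0 : a ∈ T 0) (h1 : a ∈ T 1) :
    a ∈ T 2 := by
  by_contra h2
  have huniq : ∀ i j, i ≠ j → ∀ x y, x ∈ T i → x ∈ T j → y ∈ T i → y ∈ T j → x = y := by
    intro i j hij x y hx hx' hy hy'
    exact Finset.card_le_one.1 (hi i j hij).le x (Finset.mem_inter.2 ⟨hx, hx'⟩) y
      (Finset.mem_inter.2 ⟨hy, hy'⟩)
  have hmeet : ∀ i j, i ≠ j → ∃ x, x ∈ T i ∧ x ∈ T j := by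
    intro i j hij
    obtain ⟨x, hx⟩ := Finset.card_pos.1 (by rw [hi i j hij]; norm_num : 0 < (T i ∩ T j).card)
    exact ⟨x, Finset.mem_inter.1 hx⟩
  have htwo : ∀ i x y z, x ∈ T i → y ∈ T i → z ∈ T i → x ≠ y → z = x ∨ z = y := by
    intro i x y z hx hy hz hxy
    by_contra! hcon
    have : ({x, y, z} : Finset ℕ).card ≤ (T i).card := Finset.card_le_card (by
      intro w; simp only [Finset.mem_insert, Finset.mem_singleton]; rintro (rfl | rfl | rfl) <;>
        assumption)
    rw [hT, Finset.card_eq_three.2 ⟨x, y, z, hxy, hcon.1.symm, hcon.2.symm, rfl⟩] at this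
    omega
  obtain ⟨b, hb0, hb2⟩ := hmeet 0 2 (by decide)
  obtain ⟨c, hc1, hc2⟩ := hmeet 1 2 (by decide)
  have hab : a ≠ b := by rintro rfl; exact h2 hb2
  have hac : a ≠ c := by rintro rfl; exact h2 hc2
  have hbc : b ≠ c := by
    rintro rfl; exact hab (huniq 0 1 (by decide) _ _ h0 h1 hb0 hc1)
  obtain ⟨x, hx0, hx3⟩ := hmeet 0 3 (by decide)
  obtain ⟨y, hy1, hy3⟩ := hmeet 1 3 (by decide)
  obtain ⟨z, hz2, hz3⟩ := hmeet 2 3 (by decide)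
  rcases htwo 0 a b x h0 hb0 hx0 hab with rfl | rfl
  · rcases htwo 2 b c z hb2 hc2 hz2 hbc with rfl | rfl
    · exact hab (huniq 0 3 (by decide) _ _ h0 hx3 hb0 hz3)
    · exact hac (huniq 1 3 (by decide) _ _ h1 hx3 hc1 hz3)
  · rcases htwo 1 a c y h1 hc1 hy1 hac with rfl | rfl
    · exact hab (huniq 0 3 (by decide) _ _ h0 hy3 hx0 hx3)
    · exact hbc (huniq 2 3 (by decide) _ _ hb2 hx3 hc2 hy3)

/-- A map of the two-element subsets of `ℕ` onto themselves that preserves the size of intersections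
is induced by a permutation: the image of the star of a point is the star of another point. -/
theorem exists_perm_of_card_inter {S : ℕ → ℕ → Finset ℕ} (hcard : ∀ n m, n ≠ m → (S n m).card = 2)
    (hS : ∀ n m n' m', n ≠ m → n' ≠ m' →
      (S n m ∩ S n' m').card = ({n, m} ∩ {n', m'} : Finset ℕ).card)
    (hsurj : ∀ k l, k ≠ l → ∃ n m, n ≠ m ∧ S n m = {k, l}) :
    ∃ π : Equiv.Perm ℕ, ∀ n m, n ≠ m → S n m = {π n, π m} := by
  have hstar : ∀ n m m', n ≠ m → n ≠ m' → m ≠ m' → (S n m ∩ S n m').card = 1 := by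
    intro n m m' h h' hm
    rw [hS n m n m' h h']
    have : ({n, m} ∩ {n, m'} : Finset ℕ) = {n} := by
      ext i; simp only [Finset.mem_inter, Finset.mem_insert, Finset.mem_singleton]; omega
    rw [this, Finset.card_singleton]
  have hex : ∀ n, ∃ a, ∀ m, n ≠ m → a ∈ S n m := by
    intro n
    obtain ⟨a, ha⟩ := Finset.card_pos.1 (by
      rw [hstar n (n + 1) (n + 2) (by omega) (by omega) (by omega)]; norm_num :
        0 < (S n (n + 1) ∩ S n (n + 2)).card)
    obtain ⟨ha1, ha2⟩ := Finset.mem_inter.1 ha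
    refine ⟨a, fun m hm => ?_⟩
    by_cases h1 : m = n + 1
    · rwa [h1]
    by_cases h2 : m = n + 2
    · rwa [h2]
    let v : Fin 4 → ℕ := ![n + 1, n + 2, m, n + m + 3]
    have hv : ∀ i, n ≠ v i := by intro i; fin_cases i <;> simp [v] <;> omega
    have hvi : ∀ i j, i ≠ j → v i ≠ v j := by
      intro i j hij; fin_cases i <;> fin_cases j <;> simp [v] at hij ⊢ <;> omega
    exact mem_of_card_inter_eq_one (T := fun i => S n (v i)) (fun i => hcard _ _ (hv i))
      (fun i j hij => hstar n _ _ (hv i) (hv j) (hvi i j hij)) ha1 ha2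
  choose π hπ using hex
  have hsymm : ∀ n m, n ≠ m → S n m = S m n := fun n m h =>
    Finset.eq_of_card_inter_eq_two (hcard n m h) (hcard m n h.symm) (by
      rw [hS n m m n h h.symm, Finset.pair_comm m n, Finset.inter_self, Finset.card_pair h])
  have hinj : Function.Injective π := by
    intro n n' hnn
    by_contra hne
    have h1 := hπ n (n + n' + 1) (by omega)
    have h2 := hπ n' (n + n' + 2) (by omega)
    rw [← hnn] at h2
    have h3 := hS n (n + n' + 1) n' (n + n' + 2) (by omega) (by omega)
    have h4 : ({n, n + n' + 1} ∩ {n', n + n' + 2} : Finset ℕ) = ∅ := by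
      refine Finset.eq_empty_of_forall_notMem fun i => ?_
      simp only [Finset.mem_inter, Finset.mem_insert, Finset.mem_singleton]
      omega
    rw [h4, Finset.card_empty, Finset.card_eq_zero] at h3
    have := Finset.mem_inter.2 ⟨h1, h2⟩
    rw [h3] at this
    exact absurd this (Finset.notMem_empty _)
  have hpair : ∀ n m, n ≠ m → S n m = {π n, π m} := by
    intro n m h
    refine (Finset.eq_of_subset_of_card_le ?_ ?_).symm
    · intro i
      simp only [Finset.mem_insert, Finset.mem_singleton]
      rintro (rfl | rfl)
      · exact hπ n m h
      · rw [hsymm n m h]; exact hπ m n h.symm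
    · rw [hcard n m h, Finset.card_pair (fun h' => h (hinj h'))]
  have hsur : Function.Surjective π := by
    intro k
    obtain ⟨n, m, h, hnm⟩ := hsurj k (k + 1) (by omega)
    have : k ∈ S n m := by rw [hnm]; simp
    rw [hpair n m h] at this
    simp only [Finset.mem_insert, Finset.mem_singleton] at this
    rcases this with rfl | rfl
    · exact ⟨n, rfl⟩
    · exact ⟨m, rfl⟩
  exact ⟨Equiv.ofBijective π ⟨hinj, hsur⟩, hpair⟩

/-! ### The permutation induced by a near-isometry -/

theorem norm_half_axis {n m : ℕ} (h : n ≠ m) {r : ℝ} (hr : |r| = 1 / 2) :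
    ‖r • axis n m‖ = 1 / 2 := by
  rw [norm_smul, norm_axis h, Real.norm_eq_abs, hr, mul_one]

theorem half_axis_sub (n m : ℕ) :
    (1 / 2 : ℝ) • axis n m - (-(1 / 2) : ℝ) • axis n m = axis n m := by
  rw [← sub_smul]; norm_num

theorem IsSpikeWeight.congr {κ : ℝ} {c : ℕ → ℕ → ℝ} (hc : IsSpikeWeight κ c) {n m k l : ℕ}
    (h : ({n, m} : Finset ℕ) = {k, l}) : c n m = c k l := by
  have h' : ({n, m} : Set ℕ) = {k, l} := by
    rw [← Finset.coe_pair, h, Finset.coe_pair]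
  rcases Set.pair_eq_pair_iff.1 h' with ⟨rfl, rfl⟩ | ⟨rfl, rfl⟩
  · rfl
  · exact hc.symm _ _

namespace IsNearIsometry

variable {κ ε : ℝ} {c c' : ℕ → ℕ → ℝ} {R : Ell2 → Ell2 → Prop}

theorem exists_axis_image (hR : IsNearIsometry (spikeNorm c) (spikeNorm c') ε R)
    (hc : IsSpikeWeight κ c) (hc' : IsSpikeWeight κ c') (hε0 : 0 < ε)
    (hεκ : ε ≤ (κ - 1) / 100) {n m : ℕ} (h : n ≠ m) :
    ∃ (a b : Ell2) (k l : ℕ) (t : ℝ), R ((1 / 2 : ℝ) • axis n m) a ∧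
      R ((-(1 / 2) : ℝ) • axis n m) b ∧ ‖a - b‖ ≤ 1.001 ∧ k ≠ l ∧ c n m - 8 * ε ≤ c' k l ∧ |t| = 1 ∧
      ‖(a - b) - t • axis k l‖ ≤ 0.1005 := by
  have hle : ∀ r : ℝ, |r| = 1 / 2 → spikeNorm c (r • axis n m) ≤ 1 := fun r hr =>
    (hc.spikeNorm_le _).trans (by
      rw [norm_smul, norm_axis h, Real.norm_eq_abs, hr]; norm_num)
  obtain ⟨a, ha⟩ := hR.exists_right _ (hle (1 / 2) (by norm_num [abs_of_pos]))
  obtain ⟨b, hb⟩ := hR.exists_right _ (hle (-(1 / 2)) (by rw [abs_neg]; norm_num [abs_of_pos]))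
  obtain ⟨h1, k, l, hkl, h2, t, ht, h3⟩ := hR.exists_axis hc hc' hε0 hεκ h ha hb
  exact ⟨a, b, k, l, t, ha, hb, h1, hkl, h2, ht, h3⟩

/-- A near-isometry between the unit balls of two spiked norms forces the weights to be close, up
to a permutation of the coordinates. -/
theorem exists_perm (hR : IsNearIsometry (spikeNorm c) (spikeNorm c') ε R)
    (hc : IsSpikeWeight κ c) (hc' : IsSpikeWeight κ c') (hε0 : 0 < ε)
    (hεκ : ε ≤ (κ - 1) / 100) :
    ∃ π : Equiv.Perm ℕ, ∀ n m, n ≠ m → |c n m - c' (π n) (π m)| ≤ 8 * ε := by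
  have hε : ε ≤ 0.0001 := by
    have := (hc.le 0 1 (by norm_num)).trans (hc.le_max 0 1 (by norm_num))
    linarith
  have r1 : |(1 / 2 : ℝ)| = 1 / 2 := by norm_num [abs_of_pos]
  have r2 : |(-(1 / 2) : ℝ)| = 1 / 2 := by rw [abs_neg, r1]
  have H : ∀ n m, ∃ (a b : Ell2) (k l : ℕ) (t : ℝ), n ≠ m → R ((1 / 2 : ℝ) • axis n m) a ∧
      R ((-(1 / 2) : ℝ) • axis n m) b ∧ ‖a - b‖ ≤ 1.001 ∧ k ≠ l ∧ c n m - 8 * ε ≤ c' k l ∧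
      |t| = 1 ∧ ‖(a - b) - t • axis k l‖ ≤ 0.1005 := by
    intro n m
    by_cases h : n = m
    · exact ⟨0, 0, 0, 0, 0, fun h' => absurd h h'⟩
    · obtain ⟨a, b, k, l, t, h'⟩ := hR.exists_axis_image hc hc' hε0 hεκ h
      exact ⟨a, b, k, l, t, fun _ => h'⟩
  choose a b k l t H using H
  have hcard : ∀ n m, n ≠ m → ({k n m, l n m} : Finset ℕ).card = 2 := fun n m h =>
    Finset.card_pair (H n m h).2.2.2.1
  have hinter : ∀ n m n' m', n ≠ m → n' ≠ m' →
      ({k n m, l n m} ∩ {k n' m', l n' m'} : Finset ℕ).card =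
        ({n, m} ∩ {n', m'} : Finset ℕ).card := by
    intro n m n' m' h h'
    obtain ⟨ha, hb, -, hkl, -, ht, hs⟩ := H n m h
    obtain ⟨ha', hb', hn', hkl', -, ht', hs'⟩ := H n' m' h'
    have e1 := hR.abs_inner_sub_le hc hc' hε ha hb ha' hb' le_rfl (norm_half_axis h r1).le
      (norm_half_axis h r2).le (norm_half_axis h' r1).le (norm_half_axis h' r2).le
    rw [half_axis_sub, half_axis_sub, inner_axis_axis] at e1
    have e2 := abs_inner_sub_inner_le (norm_smul_axis_of_abs_eq_one ht hkl) hn' hs hs'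
    obtain ⟨z, hz, hzc⟩ := exists_inner_smul_axis ht ht' (k n m) (l n m) (k n' m') (l n' m')
    rw [hz] at e2
    rw [abs_le] at e1 e2
    set p := ({n, m} ∩ {n', m'} : Finset ℕ).card
    -- `z / 2` and `p / 2` differ by at most `0.0208 + 0.2012 < 1 / 2`.
    have z1 : (z : ℝ) < p + 1 := by linarith
    have z2 : (p : ℝ) - 1 < z := by linarith
    have z3 : z < p + 1 := by exact_mod_cast z1
    have z4 : (p : ℤ) - 1 < z := by exact_mod_cast z2
    have z5 : z = p := by omega
    rw [z5, abs_of_nonneg (by positivity)] at hzc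
    exact_mod_cast hzc.symm
  have hback : ∀ k' l', k' ≠ l' → ∃ n m, n ≠ m ∧ ({k n m, l n m} : Finset ℕ) = {k', l'} ∧
      c' k' l' - 8 * ε ≤ c n m := by
    intro k' l' hkl'
    obtain ⟨x, y, n, m, τ, hx, hy, -, h, hle, hτ, hs'⟩ :=
      hR.symm.exists_axis_image hc' hc hε0 hεκ hkl'
    obtain ⟨ha, hb, -, hkl, -, ht, hs⟩ := H n m h
    refine ⟨n, m, h, Finset.eq_of_card_inter_eq_two (hcard n m h) (Finset.card_pair hkl') ?_, hle⟩
    have hx' := (hc.norm_le _).trans (hR.left_le _ _ hx)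
    have hy' := (hc.norm_le _).trans (hR.left_le _ _ hy)
    have e1 := hR.abs_inner_sub_le hc hc' hε hx hy ha hb (M := 2.2) (by norm_num)
      (by linarith) (by linarith) (by rw [norm_half_axis h r1]; norm_num)
      (by rw [norm_half_axis h r2]; norm_num)
    rw [half_axis_sub, half_axis_sub] at e1
    have e2 : |inner ℝ (x - y) (axis n m) - τ| ≤ 0.1005 := by
      have := (abs_inner_axis_le h ((x - y) - τ • axis n m)).trans hs'
      rwa [inner_sub_left, real_inner_smul_left, real_inner_self_eq_norm_sq, norm_axis h, one_pow,
        mul_one] at this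
    have e3 : |inner ℝ (axis k' l') (a n m - b n m) -
        inner ℝ (axis k' l') (t n m • axis (k n m) (l n m))| ≤ 0.1005 := by
      rw [← inner_sub_right, real_inner_comm]
      exact (abs_inner_axis_le hkl' _).trans hs
    obtain ⟨z, hz, hzc⟩ := exists_inner_smul_axis (t₁ := 1) (by simp) ht k' l' (k n m) (l n m)
    rw [one_smul] at hz
    rw [hz] at e3
    -- `x - y` is close to `± axis n m`, so the inner product of `axis k' l'` with the axis assigned
    -- to the pair `n, m` exceeds `1 / 2` in absolute value. Hence the two axes agree.
    have z1 : 1 < |(z : ℝ)| := by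
      rw [abs_le] at e1 e2 e3
      rcases eq_or_eq_neg_of_abs_eq hτ with h1 | h1 <;> rw [h1] at e2
      · exact lt_of_lt_of_le (by linarith) (le_abs_self _)
      · exact lt_of_lt_of_le (by linarith) (neg_le_abs _)
    have z2 : 1 < |z| := by exact_mod_cast z1
    rw [hzc, Finset.inter_comm] at z2
    have z3 : ({k n m, l n m} ∩ {k', l'} : Finset ℕ).card ≤ 2 :=
      (Finset.card_le_card Finset.inter_subset_left).trans (hcard n m h).le
    omega
  obtain ⟨π, hπ⟩ := exists_perm_of_card_inter (S := fun n m => {k n m, l n m}) hcard hinter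
    (fun k' l' h => by
      obtain ⟨n, m, h1, h2, -⟩ := hback k' l' h
      exact ⟨n, m, h1, h2⟩)
  refine ⟨π, fun n m h => abs_le.2 ⟨?_, ?_⟩⟩
  · obtain ⟨n', m', h', he, hle⟩ := hback (π n) (π m) (fun h' => h (π.injective h'))
    have hnm : ({n', m'} : Finset ℕ) = {n, m} := by
      refine Finset.eq_of_card_inter_eq_two (Finset.card_pair h') (Finset.card_pair h) ?_
      rw [← hinter n' m' n m h' h, he, hπ n m h, Finset.inter_self,
        Finset.card_pair (fun h' => h (π.injective h'))]
    rw [hc.congr hnm] at hle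
    linarith
  · have := (H n m h).2.2.2.2.1
    rw [hc'.congr (hπ n m h)] at this
    linarith

end IsNearIsometry

/-! ### The extended logarithm and Lipschitz constants -/

theorem elog_mono {x y : ℝ≥0∞} (h : x ≤ y) : elog x ≤ elog y :=
  EReal.toENNReal_le_toENNReal (ENNReal.log_le_log h)

theorem elog_ofReal_exp (t : ℝ) : elog (ENNReal.ofReal (Real.exp t)) = ENNReal.ofReal t := by
  rw [elog, ENNReal.log_ofReal_of_pos (Real.exp_pos t), Real.log_exp,
    EReal.toENNReal_of_ne_top (EReal.coe_ne_top t), EReal.toReal_coe]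

theorem elog_le_of_le_exp {x : ℝ≥0∞} {t : ℝ} (h : x ≤ ENNReal.ofReal (Real.exp t)) :
    elog x ≤ ENNReal.ofReal t :=
  (elog_mono h).trans (elog_ofReal_exp t).le

theorem lt_exp_of_elog_lt {x : ℝ≥0∞} {t : ℝ} (h : elog x < ENNReal.ofReal t) :
    x < ENNReal.ofReal (Real.exp t) := by
  by_contra! hcon
  exact absurd h (not_lt.2 ((elog_ofReal_exp t).ge.trans (elog_mono hcon)))

theorem lipNorm_le {M N : Type} [MetricSpace M] [MetricSpace N] {T : M → N} {K : ℝ}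
    (h : ∀ x y, dist (T x) (T y) ≤ K * dist x y) : lipNorm T ≤ ENNReal.ofReal K := by
  refine iSup_le fun x => iSup_le fun y => iSup_le fun hxy => ?_
  refine ENNReal.div_le_of_le_mul ?_
  rw [edist_dist, edist_dist, ← ENNReal.ofReal_mul' dist_nonneg]
  exact ENNReal.ofReal_le_ofReal (h x y)

theorem dist_le_of_lipNorm_le {M N : Type} [MetricSpace M] [MetricSpace N] {T : M → N} {K : ℝ}
    (hK : 0 ≤ K) (h : lipNorm T ≤ ENNReal.ofReal K) (x y : M) :
    dist (T x) (T y) ≤ K * dist x y := by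
  rcases eq_or_ne x y with rfl | hxy
  · simp
  · have h1 : edist (T x) (T y) / edist x y ≤ ENNReal.ofReal K :=
      (le_iSup_of_le x (le_iSup_of_le y (le_iSup_of_le hxy le_rfl)) : _ ≤ lipNorm T).trans h
    rw [ENNReal.div_le_iff (edist_pos.2 hxy).ne' (edist_ne_top x y), edist_dist, edist_dist,
      ← ENNReal.ofReal_mul hK] at h1
    exact (ENNReal.ofReal_le_ofReal_iff (by positivity)).1 h1

theorem lipNorm_restrict_le {M N : Type} [MetricSpace M] [MetricSpace N] {T : M → N}
    {A : Set M} {B : Set N} {S : A → B} (h : ∀ x, (S x : N) = T x) : lipNorm S ≤ lipNorm T := by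
  refine iSup_le fun x => iSup_le fun y => iSup_le fun hxy => ?_
  refine le_iSup_of_le (x : M) (le_iSup_of_le (y : M)
    (le_iSup_of_le (fun h' => hxy (Subtype.ext h')) ?_))
  rw [Subtype.edist_eq, Subtype.edist_eq, h, h]

theorem lipInfty_le {M N : Type} [MetricSpace M] [MetricSpace N] {T : M → N} {K : ℝ}
    (h : ∀ x y, dist (T x) (T y) ≤ K * dist x y) : lipInfty T ≤ ENNReal.ofReal K := by
  refine iInf_le_of_le 1 (iInf_le_of_le one_pos ?_)
  refine iSup_le fun x => iSup_le fun y => iSup_le fun hxy => ?_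
  refine ENNReal.div_le_of_le_mul ?_
  rw [edist_dist, edist_dist, ← ENNReal.ofReal_mul' dist_nonneg]
  exact ENNReal.ofReal_le_ofReal (h x y)

theorem exists_of_lipInfty_lt {M N : Type} [MetricSpace M] [MetricSpace N] {T : M → N} {K : ℝ}
    (hK : 0 ≤ K) (h : lipInfty T < ENNReal.ofReal K) :
    ∃ η > 0, ∀ x y, η ≤ dist x y → dist (T x) (T y) ≤ K * dist x y := by
  simp only [lipInfty, iInf_lt_iff] at h
  obtain ⟨η, hη, h⟩ := h
  refine ⟨η, hη, fun x y hxy => ?_⟩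
  have h1 : edist (T x) (T y) / edist x y ≤ ENNReal.ofReal K :=
    (le_iSup_of_le x (le_iSup_of_le y
      (le_iSup (fun _ : η ≤ dist x y => edist (T x) (T y) / edist x y) hxy))).trans h.le
  have hpos : 0 < dist x y := hη.trans_le hxy
  rw [ENNReal.div_le_iff (edist_pos.2 (dist_pos.1 hpos)).ne' (edist_ne_top x y), edist_dist,
    edist_dist, ← ENNReal.ofReal_mul hK] at h1
  exact (ENNReal.ofReal_le_ofReal_iff (by positivity)).1 h1

/-! ### Distances between nearby spaces -/

theorem exists_isNet (M : Type) [MetricSpace M] : ∃ A : Set M, IsNet A := by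
  obtain ⟨A, hA⟩ := zorn_subset {A : Set M | A.Pairwise fun x y => 1 ≤ dist x y} (by
    intro C hC hchain
    exact ⟨⋃₀ C, (pairwise_sUnion hchain.directedOn).2 fun s hs => hC hs,
      fun s hs => subset_sUnion_of_mem hs⟩)
  refine ⟨A, 1, one_pos, 1, one_pos, fun m hm n hn h => hA.prop hm hn h, fun x => ?_⟩
  by_contra! hcon
  have hins : (insert x A).Pairwise fun x y => 1 ≤ dist x y :=
    hA.prop.insert fun y hy _ => ⟨hcon y hy, by rw [dist_comm]; exact hcon y hy⟩
  have := hcon x (hA.le_of_ge hins (subset_insert x A) (mem_insert x A))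
  rw [dist_self] at this
  linarith

theorem IsNet.image {M N : Type} [MetricSpace M] [MetricSpace N] (T : M ≃ N) {K : ℝ} (hK : 0 < K)
    (h : ∀ x y, dist (T x) (T y) ≤ K * dist x y)
    (h' : ∀ x y, dist (T.symm x) (T.symm y) ≤ K * dist x y) {A : Set M} (hA : IsNet A) :
    IsNet (T '' A) := by
  obtain ⟨a, ha, b, hb, h1, h2⟩ := hA
  refine ⟨a / K, by positivity, K * b, by positivity, ?_, fun y => ?_⟩
  · rintro _ ⟨m, hm, rfl⟩ _ ⟨n, hn, rfl⟩ hne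
    have h3 := h' (T m) (T n)
    rw [T.symm_apply_apply, T.symm_apply_apply] at h3
    rw [div_le_iff₀ hK, mul_comm]
    exact (h1 m hm n hn (fun e => hne (by rw [e]))).trans h3
  · obtain ⟨n, hn, hd⟩ := h2 (T.symm y)
    refine ⟨T n, ⟨n, hn, rfl⟩, ?_⟩
    have h3 := h (T.symm y) n
    rw [T.apply_symm_apply] at h3
    exact h3.trans_lt (by gcongr)

theorem netDistance_le_lipschitzDistance (X Y : Type) [NormedAddCommGroup X]
    [NormedAddCommGroup Y] : netDistance X Y ≤ lipschitzDistance X Y := by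
  refine le_iInf fun T => le_iInf fun h => le_iInf fun h' => ?_
  obtain ⟨A, hA⟩ := exists_isNet X
  set K : ℝ := (lipNorm T).toReal + (lipNorm T.symm).toReal + 1
  have hK : 0 < K := by positivity
  have hT : ∀ x y, dist (T x) (T y) ≤ K * dist x y := dist_le_of_lipNorm_le hK.le
    (by
      rw [← ENNReal.ofReal_toReal h.ne]
      refine ENNReal.ofReal_le_ofReal ?_
      have : 0 ≤ (lipNorm T.symm).toReal := by positivity
      simp only [K]; linarith)
  have hT' : ∀ x y, dist (T.symm x) (T.symm y) ≤ K * dist x y := dist_le_of_lipNorm_le hK.le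
    (by
      rw [← ENNReal.ofReal_toReal h'.ne]
      refine ENNReal.ofReal_le_ofReal ?_
      have : 0 ≤ (lipNorm T).toReal := by positivity
      simp only [K]; linarith)
  refine iInf_le_of_le A (iInf_le_of_le hA (iInf_le_of_le (T '' A) (iInf_le_of_le
    (hA.image T hK hT hT') ?_)))
  have h1 : lipNorm (T.image A) ≤ lipNorm T := lipNorm_restrict_le fun x => rfl
  have h2 : lipNorm (T.image A).symm ≤ lipNorm T.symm := lipNorm_restrict_le fun x => by
    obtain ⟨y, rfl⟩ := (T.image A).surjective x
    rw [Equiv.symm_apply_apply]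
    exact (T.symm_apply_apply _).symm
  refine iInf_le_of_le (T.image A) (iInf_le_of_le (h1.trans_lt h)
    (iInf_le_of_le (h2.trans_lt h') (elog_mono (max_le_max h1 h2))))

section Banach

variable {X Y : Type} [NormedAddCommGroup X] [NormedSpace ℝ X]
  [NormedAddCommGroup Y] [NormedSpace ℝ Y] {θ : ℝ}

theorem banachMazurDistance_le (hθ : 0 ≤ θ) (T : X ≃L[ℝ] Y) (h : ∀ x, ‖T x‖ ≤ (1 + θ) * ‖x‖)
    (h' : ∀ y, ‖T.symm y‖ ≤ (1 + θ) * ‖y‖) : banachMazurDistance X Y ≤ ENNReal.ofReal (2 * θ) := by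
  refine iInf_le_of_le T (ENNReal.ofReal_le_ofReal ?_)
  have h1 : ‖(T : X →L[ℝ] Y)‖ ≤ 1 + θ :=
    ContinuousLinearMap.opNorm_le_bound _ (by positivity) h
  have h2 : ‖(T.symm : Y →L[ℝ] X)‖ ≤ 1 + θ :=
    ContinuousLinearMap.opNorm_le_bound _ (by positivity) h'
  have h3 : ‖(T : X →L[ℝ] Y)‖ * ‖(T.symm : Y →L[ℝ] X)‖ ≤ Real.exp (2 * θ) := by
    calc _ ≤ (1 + θ) * (1 + θ) := by gcongr
      _ ≤ Real.exp θ * Real.exp θ := by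
          have := Real.add_one_le_exp θ
          gcongr <;> linarith
      _ = _ := by rw [← Real.exp_add]; ring_nf
  rcases (mul_nonneg (norm_nonneg (T : X →L[ℝ] Y))
    (norm_nonneg (T.symm : Y →L[ℝ] X))).eq_or_lt with h4 | h4
  · rw [← h4, Real.log_zero]; positivity
  · exact (Real.log_le_iff_le_exp h4).2 h3

theorem lipschitzDistance_le (T : X ≃L[ℝ] Y) (h : ∀ x, ‖T x‖ ≤ (1 + θ) * ‖x‖)
    (h' : ∀ y, ‖T.symm y‖ ≤ (1 + θ) * ‖y‖) : lipschitzDistance X Y ≤ ENNReal.ofReal θ := by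
  have h1 : lipNorm T.toEquiv ≤ ENNReal.ofReal (1 + θ) := lipNorm_le fun x y => by
    simpa [dist_eq_norm] using h (x - y)
  have h2 : lipNorm T.toEquiv.symm ≤ ENNReal.ofReal (1 + θ) := lipNorm_le fun x y => by
    simpa [dist_eq_norm] using h' (x - y)
  refine iInf_le_of_le T.toEquiv (iInf_le_of_le (h1.trans_lt ENNReal.ofReal_lt_top)
    (iInf_le_of_le (h2.trans_lt ENNReal.ofReal_lt_top) (elog_le_of_le_exp ?_)))
  exact (max_le h1 h2).trans (ENNReal.ofReal_le_ofReal (by linarith [Real.add_one_le_exp θ]))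

theorem uniformDistance_le (hθ : 0 ≤ θ) (T : X ≃L[ℝ] Y) (h : ∀ x, ‖T x‖ ≤ (1 + θ) * ‖x‖)
    (h' : ∀ y, ‖T.symm y‖ ≤ (1 + θ) * ‖y‖) : uniformDistance X Y ≤ ENNReal.ofReal (2 * θ) := by
  have h1 : lipInfty T ≤ ENNReal.ofReal (1 + θ) := lipInfty_le fun x y => by
    simpa [dist_eq_norm] using h (x - y)
  have h2 : lipInfty T.symm ≤ ENNReal.ofReal (1 + θ) := lipInfty_le fun x y => by
    simpa [dist_eq_norm] using h' (x - y)
  let u : X ≃ᵤ Y := ⟨T.toEquiv, (T : X →L[ℝ] Y).uniformContinuous,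
    (T.symm : Y →L[ℝ] X).uniformContinuous⟩
  refine iInf_le_of_le u (elog_le_of_le_exp ?_)
  refine (mul_le_mul' (h1 : lipInfty u ≤ _) (h2 : lipInfty u.symm ≤ _)).trans ?_
  rw [← ENNReal.ofReal_mul (by positivity), two_mul, Real.exp_add]
  refine ENNReal.ofReal_le_ofReal ?_
  have := Real.add_one_le_exp θ
  gcongr <;> linarith

theorem ghBallDistance_le_kadetsDistance : ghBallDistance X Y ≤ kadetsDistance X Y := by
  refine le_iInf fun Z => le_iInf fun _ => le_iInf fun _ => le_iInf fun _ => le_iInf fun i =>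
    le_iInf fun j => ?_
  refine iInf_le_of_le Z (iInf_le_of_le inferInstance (iInf_le_of_le (fun x => i x)
    (iInf_le_of_le (i.isometry.comp isometry_subtype_coe) (iInf_le_of_le (fun y => j y)
      (iInf_le_of_le (j.isometry.comp isometry_subtype_coe) ?_)))))
  rw [image_eq_range, image_eq_range]

end Banach

/-! ### Near-isometries obtained from small distances -/

theorem exists_isNearIsometry_of_ghBallDistance_lt {X Y : Type} [NormedAddCommGroup X]
    [NormedAddCommGroup Y] {ε : ℝ} (h : ghBallDistance X Y < ENNReal.ofReal ε) :
    ∃ R : X → Y → Prop, IsNearIsometry (fun x => ‖x‖) (fun y => ‖y‖) (2 * ε) R := by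
  simp only [ghBallDistance, ghDistance, iInf_lt_iff] at h
  obtain ⟨Z, _, i, hi, j, hj, h⟩ := h
  have hd : ∀ {z w : Z}, edist z w < ENNReal.ofReal ε → dist z w ≤ ε := by
    intro z w hzw
    rw [edist_dist] at hzw
    exact ((ENNReal.ofReal_lt_ofReal_iff_of_nonneg dist_nonneg).1 hzw).le
  refine ⟨fun x y => ∃ (hx : x ∈ Metric.closedBall (0 : X) 1)
    (hy : y ∈ Metric.closedBall (0 : Y) 1), dist (i ⟨x, hx⟩) (j ⟨y, hy⟩) ≤ ε, ?_, ?_, ?_, ?_, ?_⟩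
  · intro x hx
    have hx' : x ∈ Metric.closedBall (0 : X) 1 := by simpa using hx
    obtain ⟨_, ⟨y, rfl⟩, hxy⟩ := Metric.exists_edist_lt_of_hausdorffEDist_lt
      (mem_range_self (⟨x, hx'⟩ : Metric.closedBall (0 : X) 1)) h
    exact ⟨y, hx', y.2, hd hxy⟩
  · intro y hy
    have hy' : y ∈ Metric.closedBall (0 : Y) 1 := by simpa using hy
    rw [Metric.hausdorffEDist_comm] at h
    obtain ⟨_, ⟨x, rfl⟩, hxy⟩ := Metric.exists_edist_lt_of_hausdorffEDist_lt
      (mem_range_self (⟨y, hy'⟩ : Metric.closedBall (0 : Y) 1)) h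
    exact ⟨x, x.2, hy', by rw [dist_comm]; exact hd hxy⟩
  · rintro x y ⟨hx, -⟩
    have : ‖x‖ ≤ 1 := by simpa using hx
    exact this.trans (by norm_num)
  · rintro x y ⟨-, hy, -⟩
    have : ‖y‖ ≤ 1 := by simpa using hy
    exact this.trans (by norm_num)
  · rintro x y x' y' ⟨hx, hy, h1⟩ ⟨hx', hy', h2⟩
    have e1 : ‖x - x'‖ = dist (i ⟨x, hx⟩) (i ⟨x', hx'⟩) := by
      rw [hi.dist_eq, Subtype.dist_eq, dist_eq_norm]
    have e2 : ‖y - y'‖ = dist (j ⟨y, hy⟩) (j ⟨y', hy'⟩) := by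
      rw [hj.dist_eq, Subtype.dist_eq, dist_eq_norm]
    rw [e1, e2]
    have h3 := dist_triangle4 (i ⟨x, hx⟩) (j ⟨y, hy⟩) (j ⟨y', hy'⟩) (i ⟨x', hx'⟩)
    have h4 := dist_triangle4 (j ⟨y, hy⟩) (i ⟨x, hx⟩) (i ⟨x', hx'⟩) (j ⟨y', hy'⟩)
    rw [dist_comm (j ⟨y', hy'⟩) (i ⟨x', hx'⟩)] at h3
    rw [dist_comm (j ⟨y, hy⟩) (i ⟨x, hx⟩)] at h4
    rw [abs_le]
    constructor <;> linarith

/-- Uniformly continuous maps between normed spaces are Lipschitz for large distances. -/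
theorem lipInfty_lt_top_of_uniformContinuous {X Y : Type} [NormedAddCommGroup X] [NormedSpace ℝ X]
    [NormedAddCommGroup Y] {u : X → Y} (hu : UniformContinuous u) :
    lipInfty u < ∞ := by
  obtain ⟨d, hd, h⟩ := Metric.uniformContinuous_iff.1 hu 1 one_pos
  have hstep : ∀ (k : ℕ) (x v : X), ‖v‖ < d → dist (u x) (u (x + (k : ℝ) • v)) ≤ k := by
    intro k
    induction k with
    | zero => intro x v _; simp
    | succ k ih =>
      intro x v hv
      have h1 : dist (u (x + (k : ℝ) • v)) (u (x + ((k + 1 : ℕ) : ℝ) • v)) < 1 := by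
        refine h ?_
        rw [dist_eq_norm]
        have : x + (k : ℝ) • v - (x + ((k + 1 : ℕ) : ℝ) • v) = -v := by
          push_cast; rw [add_smul, one_smul]; abel
        rwa [this, norm_neg]
      push_cast at h1 ⊢
      linarith [dist_triangle (u x) (u (x + (k : ℝ) • v)) (u (x + ((k : ℝ) + 1) • v)), ih x v hv]
  refine lt_of_le_of_lt (iInf_le_of_le d (iInf_le_of_le hd ?_) :
    _ ≤ ENNReal.ofReal (2 / d)) ENNReal.ofReal_lt_top
  refine iSup_le fun x => iSup_le fun y => iSup_le fun hxy => ?_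
  refine ENNReal.div_le_of_le_mul ?_
  rw [edist_dist, edist_dist, ← ENNReal.ofReal_mul' dist_nonneg]
  refine ENNReal.ofReal_le_ofReal ?_
  set k := ⌊dist x y / d⌋₊ + 1 with hk
  have hk1 : dist x y / d < k := by rw [hk]; push_cast; exact Nat.lt_floor_add_one _
  have hk0 : (0 : ℝ) < k := by rw [hk]; positivity
  have hk2 : (k : ℝ) ≤ 2 / d * dist x y := by
    rw [hk]; push_cast
    have h1 := Nat.floor_le (show 0 ≤ dist x y / d by positivity)
    have h2 : 1 ≤ dist x y / d := by rwa [one_le_div hd]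
    have h3 : 2 / d * dist x y = dist x y / d + dist x y / d := by ring
    linarith
  have h4 := hstep k x ((k : ℝ)⁻¹ • (y - x)) (by
    rw [norm_smul, norm_inv, Real.norm_eq_abs, abs_of_pos hk0, ← dist_eq_norm, dist_comm,
      inv_mul_lt_iff₀ hk0]
    rwa [div_lt_iff₀ hd] at hk1)
  rw [smul_smul, mul_inv_cancel₀ hk0.ne', one_smul, add_sub_cancel] at h4
  exact h4.trans hk2

/-- A Lipschitz estimate for large distances holds for all distances up to an additive constant. -/
theorem exists_norm_sub_le_of_lipInfty_lt {X Y : Type} [NormedAddCommGroup X] [NormedSpace ℝ X]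
    [NormedAddCommGroup Y] [Nontrivial X] {u : X → Y} {K : ℝ} (hK : 0 ≤ K)
    (h : lipInfty u < ENNReal.ofReal K) :
    ∃ C, 0 ≤ C ∧ ∀ x y, ‖u x - u y‖ ≤ K * ‖x - y‖ + C := by
  obtain ⟨η, hη, hu⟩ := exists_of_lipInfty_lt hK h
  refine ⟨5 * η * K, by positivity, fun x y => ?_⟩
  simp only [dist_eq_norm] at hu
  by_cases hxy : η ≤ ‖x - y‖
  · have := hu x y hxy
    have : 0 ≤ 5 * η * K := by positivity
    linarith
  · obtain ⟨v, hv⟩ := exists_norm_eq X (show 0 ≤ 2 * η by positivity)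
    have e1 : ‖x - (x + v)‖ = 2 * η := by rw [sub_add_cancel_left, norm_neg, hv]
    have e2 : ‖(x + v) - y‖ ≤ 3 * η := by
      have : x + v - y = (x - y) + v := by abel
      rw [this]
      exact (norm_add_le _ _).trans (by linarith)
    have e3 : η ≤ ‖(x + v) - y‖ := by
      have := norm_sub_norm_le v (-(x - y))
      rw [norm_neg, hv] at this
      have h' : v - -(x - y) = x + v - y := by abel
      rw [h'] at this
      linarith
    have h1 := hu x (x + v) (by linarith)
    have h2 := hu (x + v) y e3
    have h3 := norm_sub_le_norm_sub_add_norm_sub (u x) (u (x + v)) (u y)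
    have h4 : K * ‖x + v - y‖ ≤ K * (3 * η) := by gcongr
    have h5 : 0 ≤ K * ‖x - y‖ := by positivity
    rw [e1] at h1
    linarith

section Coarse

variable {X Y : Type} [NormedAddCommGroup X] [NormedSpace ℝ X]
  [NormedAddCommGroup Y] [NormedSpace ℝ Y]

/-- A correspondence between coarsely dense subsets of two normed spaces that is Lipschitz in both
directions, with constants `K` and `K'`, up to the additive constant `C`. -/
structure IsCoarseEquiv (S : X → Y → Prop) (K K' C : ℝ) : Prop where
  dense_left : ∀ x, ∃ a b, S a b ∧ ‖x - a‖ ≤ C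
  dense_right : ∀ y, ∃ a b, S a b ∧ ‖y - b‖ ≤ C
  right_le : ∀ a b a' b', S a b → S a' b' → ‖b - b'‖ ≤ K * ‖a - a'‖ + C
  left_le : ∀ a b a' b', S a b → S a' b' → ‖a - a'‖ ≤ K' * ‖b - b'‖ + C

/-- Additive constants disappear under rescaling, so a coarse equivalence with `K * K'` close to `1`
yields a near-isometry between the unit balls. -/
theorem IsCoarseEquiv.exists_isNearIsometry {S : X → Y → Prop} {K K' C ε : ℝ}
    (h : IsCoarseEquiv S K K' C) (hK : 0 < K) (hK' : 0 ≤ K') (hε : 0 < ε) (hε' : ε ≤ 0.1)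
    (hKK : K * K' ≤ 1 + ε / 3) :
    ∃ R : X → Y → Prop, IsNearIsometry (fun x => ‖x‖) (fun y => ‖y‖) ε R := by
  obtain ⟨a₀, b₀, h₀, hC0⟩ := h.dense_left 0
  have hC : 0 ≤ C := (norm_nonneg _).trans hC0
  -- The additive errors sum up to less than `D`; the scale `Λ` makes them at most `ε / 4`.
  set D : ℝ := 3 * C + 3 * (C / K) + 2 * (K' * C) + 1 with hD
  have hCK : 0 ≤ C / K := by positivity
  have hKC : 0 ≤ K' * C := by positivity
  set Λ : ℝ := 4 * D / ε with hΛdef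
  have hDpos : 0 < D := by positivity
  have hΛ : 0 < Λ := by positivity
  have hDΛ : D = ε / 4 * Λ := by rw [hΛdef]; field_simp
  have hKΛ : 0 < K * Λ := by positivity
  have hCC : K * (C / K) = C := by field_simp
  have scale : ∀ {E : Type} [NormedAddCommGroup E] [NormedSpace ℝ E] (r : ℝ), 0 < r →
      ∀ (e a a' x x' : E), ‖e + r • x - a‖ ≤ C → ‖e + r • x' - a'‖ ≤ C →
        r * ‖x - x'‖ ≤ ‖a - a'‖ + 2 * C ∧ ‖a - a'‖ ≤ r * ‖x - x'‖ + 2 * C := by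
    intro E _ _ r hr e a a' x x' h1 h2
    have e1 : r * ‖x - x'‖ = ‖r • (x - x')‖ := by rw [norm_smul, Real.norm_eq_abs, abs_of_pos hr]
    have e2 : r • (x - x') = (a - a') + ((e + r • x - a) - (e + r • x' - a')) := by
      rw [smul_sub]; abel
    have e3 : a - a' = r • (x - x') - ((e + r • x - a) - (e + r • x' - a')) := by
      rw [smul_sub]; abel
    have h3 := norm_sub_le (e + r • x - a) (e + r • x' - a')
    constructor
    · rw [e1, e2]
      exact (norm_add_le _ _).trans (by linarith)
    · rw [e1]
      calc ‖a - a'‖ = ‖r • (x - x') - ((e + r • x - a) - (e + r • x' - a'))‖ := by rw [← e3]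
        _ ≤ _ := (norm_sub_le _ _).trans (by linarith)
  have unscale : ∀ {E : Type} [NormedAddCommGroup E] [NormedSpace ℝ E] (r : ℝ), 0 < r →
      ∀ e a : E, e + r • (r⁻¹ • (a - e)) - a = 0 ∧ ‖r⁻¹ • (a - e)‖ = ‖a - e‖ / r := by
    intro E _ _ r hr e a
    refine ⟨by rw [smul_smul, mul_inv_cancel₀ hr.ne', one_smul]; abel, ?_⟩
    rw [norm_smul, norm_inv, Real.norm_eq_abs, abs_of_pos hr, div_eq_inv_mul]
  refine ⟨fun x y => ‖x‖ ≤ 11 / 10 ∧ ‖y‖ ≤ 11 / 10 ∧ ∃ a b, S a b ∧ ‖a₀ + Λ • x - a‖ ≤ C ∧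
    ‖b₀ + (K * Λ) • y - b‖ ≤ C, ?_, ?_, fun x y h => h.1, fun x y h => h.2.1, ?_⟩
  · intro x hx
    obtain ⟨a, b, hab, hd⟩ := h.dense_left (a₀ + Λ • x)
    obtain ⟨u1, u2⟩ := unscale (K * Λ) hKΛ b₀ b
    refine ⟨(K * Λ)⁻¹ • (b - b₀), hx.trans (by norm_num), ?_, a, b, hab, hd, ?_⟩
    · rw [u2, div_le_iff₀ hKΛ]
      have h1 := h.right_le a b a₀ b₀ hab h₀
      have h2 : ‖a - a₀‖ ≤ Λ + C := by
        have : a - a₀ = Λ • x - (a₀ + Λ • x - a) := by abel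
        rw [this]
        refine (norm_sub_le _ _).trans (add_le_add ?_ hd)
        rw [norm_smul, Real.norm_eq_abs, abs_of_pos hΛ]
        exact mul_le_of_le_one_right hΛ.le hx
      calc ‖b - b₀‖ ≤ K * (Λ + C) + K * (C / K) := by
            rw [hCC]; refine h1.trans ?_; gcongr
        _ = K * (Λ + (C + C / K)) := by ring
        _ ≤ K * (11 / 10 * Λ) := by
            gcongr
            nlinarith
        _ = _ := by ring
    · rw [u1, norm_zero]; exact hC
  · intro y hy
    obtain ⟨a, b, hab, hd⟩ := h.dense_right (b₀ + (K * Λ) • y)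
    obtain ⟨u1, u2⟩ := unscale Λ hΛ a₀ a
    refine ⟨Λ⁻¹ • (a - a₀), ?_, hy.trans (by norm_num), a, b, hab, ?_, hd⟩
    · rw [u2, div_le_iff₀ hΛ]
      have h1 := h.left_le a b a₀ b₀ hab h₀
      have h2 : ‖b - b₀‖ ≤ K * Λ + C := by
        have : b - b₀ = (K * Λ) • y - (b₀ + (K * Λ) • y - b) := by abel
        rw [this]
        refine (norm_sub_le _ _).trans (add_le_add ?_ hd)
        rw [norm_smul, Real.norm_eq_abs, abs_of_pos hKΛ]
        exact mul_le_of_le_one_right hKΛ.le hy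
      calc ‖a - a₀‖ ≤ K' * (K * Λ + C) + C := by refine h1.trans ?_; gcongr
        _ = K * K' * Λ + (K' * C + C) := by ring
        _ ≤ (1 + ε / 3) * Λ + ε / 4 * Λ := by gcongr; linarith
        _ ≤ _ := by nlinarith
    · rw [u1, norm_zero]; exact hC
  · rintro x y x' y' ⟨hx, hy, a, b, hab, ha, hb⟩ ⟨hx', hy', a', b', hab', ha', hb'⟩
    obtain ⟨s1, s2⟩ := scale Λ hΛ _ _ _ _ _ ha ha'
    obtain ⟨s3, s4⟩ := scale (K * Λ) hKΛ _ _ _ _ _ hb hb'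
    have h1 := h.right_le _ _ _ _ hab hab'
    have h2 := h.left_le _ _ _ _ hab hab'
    have hyy : ‖y - y'‖ ≤ 2.2 := (norm_sub_le _ _).trans (by linarith)
    rw [abs_le]
    constructor
    · have h3 : K * Λ * ‖y - y'‖ ≤ K * Λ * (‖x - x'‖ + ε) := by
        calc K * Λ * ‖y - y'‖ ≤ K * (Λ * ‖x - x'‖ + 2 * C) + C + 2 * C := by
              have : K * ‖a - a'‖ ≤ K * (Λ * ‖x - x'‖ + 2 * C) := by gcongr
              linarith
          _ = K * (Λ * ‖x - x'‖ + 2 * C + 3 * (C / K)) := by linear_combination (-3 : ℝ) * hCC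
          _ ≤ K * (Λ * ‖x - x'‖ + Λ * ε) := by
              refine mul_le_mul_of_nonneg_left ?_ hK.le
              have : 0 ≤ Λ * ε := by positivity
              linarith
          _ = _ := by ring
      have := le_of_mul_le_mul_left h3 hKΛ
      linarith
    · have h3 : Λ * ‖x - x'‖ ≤ Λ * (‖y - y'‖ + ε) := by
        calc Λ * ‖x - x'‖ ≤ K' * (K * Λ * ‖y - y'‖ + 2 * C) + C + 2 * C := by
              have : K' * ‖b - b'‖ ≤ K' * (K * Λ * ‖y - y'‖ + 2 * C) := by gcongr
              linarith
          _ = K * K' * (Λ * ‖y - y'‖) + (2 * (K' * C) + 3 * C) := by ring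
          _ ≤ (1 + ε / 3) * (Λ * ‖y - y'‖) + ε / 4 * Λ := by gcongr; linarith
          _ = Λ * (‖y - y'‖ + (ε / 3 * ‖y - y'‖ + ε / 4)) := by ring
          _ ≤ Λ * (‖y - y'‖ + ε) := by
              gcongr
              nlinarith
      have := le_of_mul_le_mul_left h3 hΛ
      linarith

theorem exp_le_one_add_two_mul {t : ℝ} (h0 : 0 ≤ t) (h1 : t ≤ 1) : Real.exp t ≤ 1 + 2 * t := by
  have := Real.abs_exp_sub_one_le (by rwa [abs_of_nonneg h0])
  rw [abs_of_nonneg h0] at this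
  linarith [abs_le.1 this]

theorem exists_isNearIsometry_of_banachMazurDistance_lt [Nontrivial X] {t : ℝ} (ht : 0 < t)
    (ht' : t ≤ 0.01) (h : banachMazurDistance X Y < ENNReal.ofReal t) :
    ∃ R : X → Y → Prop, IsNearIsometry (fun x => ‖x‖) (fun y => ‖y‖) (6 * t) R := by
  simp only [banachMazurDistance, iInf_lt_iff] at h
  obtain ⟨T, h⟩ := h
  have hT : 0 < ‖(T : X →L[ℝ] Y)‖ := by
    rw [norm_pos_iff]
    intro h0
    obtain ⟨x, hx⟩ := exists_ne (0 : X)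
    exact hx (T.injective (by
      have := congrArg (fun L : X →L[ℝ] Y => L x) h0
      simpa using this))
  refine IsCoarseEquiv.exists_isNearIsometry (S := fun x y => T x = y) (K := ‖(T : X →L[ℝ] Y)‖)
    (K' := ‖(T.symm : Y →L[ℝ] X)‖) (C := 0) ⟨fun x => ⟨x, T x, rfl, by simp⟩,
      fun y => ⟨T.symm y, y, by simp, by simp⟩, ?_, ?_⟩ hT (norm_nonneg _) (by positivity)
      (by linarith) ?_
  · rintro a _ a' _ rfl rfl
    rw [← map_sub, add_zero]
    exact (T : X →L[ℝ] Y).le_opNorm (a - a')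
  · rintro a _ a' _ rfl rfl
    rw [← map_sub, add_zero]
    simpa using (T.symm : Y →L[ℝ] X).le_opNorm (T (a - a'))
  · have h1 := (ENNReal.ofReal_lt_ofReal_iff ht).1 h
    rcases (mul_nonneg hT.le (norm_nonneg (T.symm : Y →L[ℝ] X))).eq_or_lt with h4 | h4
    · rw [← h4]; linarith
    · have := (Real.log_le_iff_le_exp h4).1 h1.le
      linarith [exp_le_one_add_two_mul ht.le (by linarith)]

theorem exists_isNearIsometry_of_netDistance_lt {t : ℝ} (ht : 0 < t)
    (ht' : t ≤ 0.005) (h : netDistance X Y < ENNReal.ofReal t) :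
    ∃ R : X → Y → Prop, IsNearIsometry (fun x => ‖x‖) (fun y => ‖y‖) (12 * t) R := by
  simp only [netDistance, lipschitzDistance, iInf_lt_iff] at h
  obtain ⟨A, ⟨-, -, b, hb, -, hA⟩, B, ⟨-, -, b', hb', -, hB⟩, T, -, -, h⟩ := h
  have h1 := (lt_exp_of_elog_lt h).le
  have hT := dist_le_of_lipNorm_le (Real.exp_pos t).le ((le_max_left _ _).trans h1)
  have hT' := dist_le_of_lipNorm_le (Real.exp_pos t).le ((le_max_right _ _).trans h1)
  refine IsCoarseEquiv.exists_isNearIsometry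
    (S := fun (x : X) (y : Y) => ∃ a : A, (a : X) = x ∧ (T a : Y) = y)
    (K := Real.exp t) (K' := Real.exp t) (C := b + b') ⟨fun x => ?_, fun y => ?_, ?_, ?_⟩
    (Real.exp_pos t) (Real.exp_pos t).le (by positivity) (by linarith) ?_
  · obtain ⟨a, ha, hd⟩ := hA x
    exact ⟨a, T ⟨a, ha⟩, ⟨⟨a, ha⟩, rfl, rfl⟩, by rw [← dist_eq_norm]; linarith⟩
  · obtain ⟨a, ha, hd⟩ := hB y
    exact ⟨T.symm ⟨a, ha⟩, a, ⟨T.symm ⟨a, ha⟩, rfl, by simp⟩, by rw [← dist_eq_norm]; linarith⟩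
  · rintro _ _ _ _ ⟨x, rfl, rfl⟩ ⟨x', rfl, rfl⟩
    have : dist (T x : Y) (T x') ≤ Real.exp t * dist (x : X) x' := hT x x'
    rw [dist_eq_norm, dist_eq_norm] at this
    linarith
  · rintro _ _ _ _ ⟨x, rfl, rfl⟩ ⟨x', rfl, rfl⟩
    have : dist (T.symm (T x) : X) (T.symm (T x')) ≤ Real.exp t * dist (T x : Y) (T x') :=
      hT' (T x) (T x')
    rw [T.symm_apply_apply, T.symm_apply_apply, dist_eq_norm, dist_eq_norm] at this
    linarith
  · rw [← Real.exp_add]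
    linarith [exp_le_one_add_two_mul (t := t + t) (by linarith) (by linarith)]

theorem exists_isNearIsometry_of_uniformDistance_lt [Nontrivial X] [Nontrivial Y] {t : ℝ}
    (ht : 0 < t) (ht' : t ≤ 0.01) (h : uniformDistance X Y < ENNReal.ofReal t) :
    ∃ R : X → Y → Prop, IsNearIsometry (fun x => ‖x‖) (fun y => ‖y‖) (6 * t) R := by
  simp only [uniformDistance, iInf_lt_iff] at h
  obtain ⟨u, h⟩ := h
  have h1 := lt_exp_of_elog_lt h
  -- Both factors are finite, so the product is not of the form `0 * ∞`.
  have f1 := lipInfty_lt_top_of_uniformContinuous u.uniformContinuous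
  have f2 := lipInfty_lt_top_of_uniformContinuous u.symm.uniformContinuous
  obtain ⟨s, hs, hst⟩ : ∃ s > 0, ((lipInfty u).toReal + s) * ((lipInfty u.symm).toReal + s) <
      Real.exp t := by
    have hc : Filter.Tendsto (fun s : ℝ => ((lipInfty u).toReal + s) *
        ((lipInfty u.symm).toReal + s)) (nhdsWithin 0 (Ioi 0))
        (nhds (((lipInfty u).toReal + 0) * ((lipInfty u.symm).toReal + 0))) :=
      (Continuous.tendsto (by fun_prop) 0).mono_left nhdsWithin_le_nhds
    have hlt : ((lipInfty u).toReal + 0) * ((lipInfty u.symm).toReal + 0) < Real.exp t := by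
      rw [add_zero, add_zero, ← ENNReal.toReal_mul]
      exact (ENNReal.lt_ofReal_iff_toReal_lt (ENNReal.mul_ne_top f1.ne f2.ne)).1 h1
    obtain ⟨s, hs, hs'⟩ := ((hc.eventually_lt_const hlt).and self_mem_nhdsWithin).exists
    exact ⟨s, hs', hs⟩
  have k1 : 0 < (lipInfty u).toReal + s := by positivity
  have k2 : 0 < (lipInfty u.symm).toReal + s := by positivity
  obtain ⟨C, hC, hu⟩ := exists_norm_sub_le_of_lipInfty_lt k1.le
    ((ENNReal.lt_ofReal_iff_toReal_lt f1.ne).2 (by linarith))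
  obtain ⟨C', hC', hu'⟩ := exists_norm_sub_le_of_lipInfty_lt k2.le
    ((ENNReal.lt_ofReal_iff_toReal_lt f2.ne).2 (by linarith))
  refine IsCoarseEquiv.exists_isNearIsometry (S := fun x y => u x = y) (C := C + C')
    ⟨fun x => ⟨x, u x, rfl, by simp; linarith⟩, fun y => ⟨u.symm y, y, by simp, by simp; linarith⟩,
      ?_, ?_⟩ k1 k2.le (by positivity) (by linarith)
    (by linarith [exp_le_one_add_two_mul ht.le (by linarith)])
  · rintro a _ a' _ rfl rfl
    linarith [hu a a']
  · rintro a _ a' _ rfl rfl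
    have := hu' (u a) (u a')
    simp only [UniformEquiv.symm_apply_apply] at this
    linarith

end Coarse

/-! ### Permutations of coordinates -/

theorem memℓp_perm (π : Equiv.Perm ℕ) (x : Ell2) : Memℓp (fun n => x (π n)) 2 := by
  have h := (memℓp_gen_iff (by norm_num)).1 (lp.memℓp x)
  exact memℓp_gen ((Equiv.summable_iff π).2 h)

/-- The isometry of `ℓ₂` that permutes the coordinates. -/
def permL2 (π : Equiv.Perm ℕ) : Ell2 ≃ₗᵢ[ℝ] Ell2 where
  toFun x := ⟨fun n => x (π n), memℓp_perm π x⟩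
  invFun x := ⟨fun n => x (π.symm n), memℓp_perm π.symm x⟩
  map_add' _ _ := rfl
  map_smul' _ _ := rfl
  left_inv x := by ext n; simp
  right_inv x := by ext n; simp
  norm_map' x := by
    rw [lp.norm_eq_tsum_rpow (by norm_num), lp.norm_eq_tsum_rpow (by norm_num)]
    congr 1
    exact Equiv.tsum_eq π fun n => ‖x n‖ ^ (2 : ℝ≥0∞).toReal

theorem permL2_apply (π : Equiv.Perm ℕ) (x : Ell2) (n : ℕ) : permL2 π x n = x (π n) := rfl

theorem inner_permL2 (π : Equiv.Perm ℕ) (x : Ell2) {n m : ℕ} (h : n ≠ m) :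
    inner ℝ (permL2 π x) (axis n m) = inner ℝ x (axis (π n) (π m)) := by
  rw [inner_axis_right h, inner_axis_right (fun e => h (π.injective e)), permL2_apply,
    permL2_apply]

theorem IsSpikeWeight.perm {κ : ℝ} {c : ℕ → ℕ → ℝ} (hc : IsSpikeWeight κ c) (π : Equiv.Perm ℕ) :
    IsSpikeWeight κ (fun n m => c (π n) (π m)) where
  one_lt := hc.one_lt
  symm _ _ := hc.symm _ _
  le _ _ h := hc.le _ _ fun e => h (π.injective e)
  le_max _ _ h := hc.le_max _ _ fun e => h (π.injective e)

theorem IsSpikeWeight.spikeNorm_permL2 {κ : ℝ} {c : ℕ → ℕ → ℝ} (hc : IsSpikeWeight κ c)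
    (π : Equiv.Perm ℕ) (x : Ell2) :
    spikeNorm (fun n m => c (π n) (π m)) (permL2 π x) = spikeNorm c x := by
  refine le_antisymm ?_ ?_
  · rw [(hc.perm π).spikeNorm_le_iff]
    refine ⟨by rw [LinearIsometryEquiv.norm_map]; exact hc.norm_le x, fun n m h => ?_⟩
    rw [inner_permL2 π x h]
    exact hc.inner_le (fun e => h (π.injective e)) x
  · rw [hc.spikeNorm_le_iff]
    refine ⟨by rw [← (permL2 π).norm_map x]; exact (hc.perm π).norm_le _, fun n m h => ?_⟩
    have h' : π.symm n ≠ π.symm m := fun e => h (π.symm.injective e)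
    have := (hc.perm π).inner_le h' (permL2 π x)
    rw [inner_permL2 π x h'] at this
    simpa using this

/-! ### Spiked norms with nearby weights -/

theorem IsSpikeWeight.spikeNorm_le_mul {κ θ : ℝ} {c c' : ℕ → ℕ → ℝ} (hc : IsSpikeWeight κ c)
    (hc' : IsSpikeWeight κ c') (hθ : 0 ≤ θ) (h : ∀ n m, n ≠ m → |c n m - c' n m| ≤ θ) (x : Ell2) :
    spikeNorm c' x ≤ (1 + θ) * spikeNorm c x := by
  rw [hc'.spikeNorm_le_iff]
  have h1 := hc.norm_le x
  refine ⟨by nlinarith [norm_nonneg x], fun n m hnm => ?_⟩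
  have h2 := hc.inner_le hnm x
  have h3 := abs_le.1 (h n m hnm)
  have h4 := hc.le n m hnm
  have h5 := hc.one_lt
  calc c' n m * |inner ℝ x (axis n m)| ≤ ((1 + θ) * c n m) * |inner ℝ x (axis n m)| := by
        gcongr
        nlinarith
    _ = (1 + θ) * (c n m * |inner ℝ x (axis n m)|) := by ring
    _ ≤ _ := by gcongr

section Model

variable {X Y : Type} [NormedAddCommGroup X] [NormedSpace ℝ X]
  [NormedAddCommGroup Y] [NormedSpace ℝ Y] {κ θ : ℝ} {c c' : ℕ → ℕ → ℝ}

theorem exists_continuousLinearEquiv (hc : IsSpikeWeight κ c) (hc' : IsSpikeWeight κ c')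
    (hθ : 0 ≤ θ) (h : ∀ n m, n ≠ m → |c n m - c' n m| ≤ θ)
    {T : X ≃ₗ[ℝ] Ell2} (hT : ∀ x, spikeNorm c (T x) = ‖x‖)
    {T' : Y ≃ₗ[ℝ] Ell2} (hT' : ∀ y, spikeNorm c' (T' y) = ‖y‖) :
    ∃ A : X ≃L[ℝ] Y, (∀ x, ‖A x‖ ≤ (1 + θ) * ‖x‖) ∧ ∀ y, ‖A.symm y‖ ≤ (1 + θ) * ‖y‖ := by
  have h1 : ∀ x, ‖(T.trans T'.symm) x‖ ≤ (1 + θ) * ‖x‖ := fun x => by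
    rw [← hT', ← hT]
    simpa using hc.spikeNorm_le_mul hc' hθ h (T x)
  have h2 : ∀ y, ‖(T.trans T'.symm).symm y‖ ≤ (1 + θ) * ‖y‖ := fun y => by
    rw [← hT', ← hT]
    simpa using hc'.spikeNorm_le_mul hc hθ (fun n m hnm => by
      rw [abs_sub_comm]; exact h n m hnm) (T' y)
  exact ⟨(T.trans T'.symm).toContinuousLinearEquivOfBounds _ _ h1 h2, h1, h2⟩

theorem IsSpikeWeight.norm_spike_le (hc : IsSpikeWeight κ c) (x : Ell2) (p : ℕ × ℕ) :
    ‖if p.1 = p.2 then 0 else c p.1 p.2 * inner ℝ x (axis p.1 p.2)‖ ≤ spikeNorm c x := by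
  split_ifs with h
  · rw [norm_zero]; exact (norm_nonneg x).trans (hc.norm_le x)
  · rw [norm_mul, Real.norm_eq_abs, Real.norm_eq_abs, abs_of_pos (hc.pos h)]
    exact hc.inner_le h x

/-- The values of the spike functionals at `x`. -/
def spikeValues (hc : IsSpikeWeight κ c) (x : Ell2) : BoundedContinuousFunction (ℕ × ℕ) ℝ :=
  BoundedContinuousFunction.ofNormedAddCommGroupDiscrete
    (fun p => if p.1 = p.2 then 0 else c p.1 p.2 * inner ℝ x (axis p.1 p.2)) (spikeNorm c x)
    (hc.norm_spike_le x)

theorem spikeValues_apply (hc : IsSpikeWeight κ c) (x : Ell2) (p : ℕ × ℕ) :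
    spikeValues hc x p = if p.1 = p.2 then 0 else c p.1 p.2 * inner ℝ x (axis p.1 p.2) := rfl

/-- The embedding of `ℓ₂` with a spiked norm into `ℓ₂ × ℓ_∞` that lists the values of all norming
functionals. Different weights give embeddings into the same space. -/
def spikeEmbedding (hc : IsSpikeWeight κ c) {T : X ≃ₗ[ℝ] Ell2}
    (hT : ∀ x, spikeNorm c (T x) = ‖x‖) :
    X →ₗᵢ[ℝ] Ell2 × BoundedContinuousFunction (ℕ × ℕ) ℝ where
  toFun x := (T x, spikeValues hc (T x))
  map_add' x y := by
    refine Prod.ext (map_add T x y) (BoundedContinuousFunction.ext fun p => ?_)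
    simp only [Prod.snd_add, BoundedContinuousFunction.add_apply, spikeValues_apply, map_add,
      inner_add_left]
    split_ifs <;> ring
  map_smul' a x := by
    refine Prod.ext (map_smul T a x) (BoundedContinuousFunction.ext fun p => ?_)
    simp only [Prod.smul_snd, BoundedContinuousFunction.smul_apply, spikeValues_apply, map_smul,
      real_inner_smul_left, smul_eq_mul, RingHom.id_apply]
    split_ifs <;> ring
  norm_map' x := by
    rw [← hT]
    refine le_antisymm (max_le (hc.norm_le _) ?_) (hc.spikeNorm_le_iff.2 ⟨le_max_left _ _, ?_⟩)
    · exact (BoundedContinuousFunction.norm_le ((norm_nonneg _).trans (hc.norm_le _))).2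
        (hc.norm_spike_le (T x))
    · intro n m h
      have h1 := (spikeValues hc (T x)).norm_coe_le_norm (n, m)
      rw [spikeValues_apply, if_neg h, norm_mul, Real.norm_eq_abs, Real.norm_eq_abs,
        abs_of_pos (hc.pos h)] at h1
      exact h1.trans (le_max_right _ _)

theorem spikeEmbedding_apply (hc : IsSpikeWeight κ c) {T : X ≃ₗ[ℝ] Ell2}
    (hT : ∀ x, spikeNorm c (T x) = ‖x‖) (x : X) :
    spikeEmbedding hc hT x = (T x, spikeValues hc (T x)) := rfl

theorem exists_dist_spikeEmbedding_le (hc : IsSpikeWeight κ c) (hc' : IsSpikeWeight κ c')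
    (hθ : 0 ≤ θ) (h : ∀ n m, n ≠ m → |c n m - c' n m| ≤ θ)
    {T : X ≃ₗ[ℝ] Ell2} (hT : ∀ x, spikeNorm c (T x) = ‖x‖)
    {T' : Y ≃ₗ[ℝ] Ell2} (hT' : ∀ y, spikeNorm c' (T' y) = ‖y‖) {x : X} (hx : ‖x‖ ≤ 1) :
    ∃ y : Y, ‖y‖ ≤ 1 ∧ dist (spikeEmbedding hc hT x) (spikeEmbedding hc' hT' y) ≤ 2 * θ := by
  set u := T x with hu
  set r : ℝ := (1 + θ)⁻¹ with hr
  have hr0 : 0 < r := by positivity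
  have hr1 : r * (1 + θ) = 1 := inv_mul_cancel₀ (by positivity)
  have hr2 : r ≤ 1 := by nlinarith
  have hux : spikeNorm c u ≤ 1 := by rw [hu, hT]; exact hx
  have hu' : spikeNorm c' u ≤ 1 + θ := by
    have := hc.spikeNorm_le_mul hc' hθ h u
    nlinarith
  have hu1 : ‖u‖ ≤ 1 := (hc.norm_le u).trans hux
  refine ⟨T'.symm (r • u), ?_, ?_⟩
  · rw [← hT', LinearEquiv.apply_symm_apply, hc'.spikeNorm_smul, abs_of_pos hr0, ← hr1]
    gcongr
  · rw [spikeEmbedding_apply, spikeEmbedding_apply, LinearEquiv.apply_symm_apply, Prod.dist_eq]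
    refine max_le ?_ ((BoundedContinuousFunction.dist_le (by positivity)).2 fun p => ?_)
    · have : u - r • u = (1 - r) • u := by rw [sub_smul, one_smul]
      rw [dist_eq_norm, ← hu, this, norm_smul, Real.norm_eq_abs, abs_of_nonneg (by linarith)]
      nlinarith [norm_nonneg u]
    · rw [spikeValues_apply, spikeValues_apply]
      split_ifs with hp
      · simpa using hθ
      · rw [← hu, real_inner_smul_left, Real.dist_eq]
        have a1 := abs_inner_axis_le hp u
        have a2 := hc'.inner_le hp u
        have a3 := h _ _ hp
        set s := inner ℝ u (axis p.1 p.2)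
        have e : c p.1 p.2 * s - c' p.1 p.2 * (r * s) =
            (c p.1 p.2 - c' p.1 p.2) * s + r * θ * (c' p.1 p.2 * s) := by
          linear_combination (-c' p.1 p.2 * s) * hr1
        rw [e]
        have b1 : |(c p.1 p.2 - c' p.1 p.2) * s| ≤ θ * 1 := by
          rw [abs_mul]
          exact mul_le_mul a3 (a1.trans hu1) (abs_nonneg _) hθ
        have b2 : |r * θ * (c' p.1 p.2 * s)| ≤ r * θ * (1 + θ) := by
          rw [abs_mul, abs_mul (c' _ _), abs_of_pos (hc'.pos hp),
            abs_of_nonneg (by positivity : 0 ≤ r * θ)]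
          gcongr
          exact a2.trans hu'
        have b3 : r * θ * (1 + θ) = θ := by linear_combination θ * hr1
        exact (abs_add_le _ _).trans (by linarith)

theorem kadetsDistance_le (hc : IsSpikeWeight κ c) (hc' : IsSpikeWeight κ c')
    (hθ : 0 ≤ θ) (h : ∀ n m, n ≠ m → |c n m - c' n m| ≤ θ)
    {T : X ≃ₗ[ℝ] Ell2} (hT : ∀ x, spikeNorm c (T x) = ‖x‖)
    {T' : Y ≃ₗ[ℝ] Ell2} (hT' : ∀ y, spikeNorm c' (T' y) = ‖y‖) :
    kadetsDistance X Y ≤ ENNReal.ofReal (2 * θ) := by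
  refine iInf_le_of_le (Ell2 × BoundedContinuousFunction (ℕ × ℕ) ℝ) (iInf_le_of_le inferInstance
    (iInf_le_of_le inferInstance (iInf_le_of_le inferInstance (iInf_le_of_le (spikeEmbedding hc hT)
      (iInf_le_of_le (spikeEmbedding hc' hT') ?_)))))
  refine Metric.hausdorffEDist_le_of_mem_edist ?_ ?_
  · rintro _ ⟨x, hx, rfl⟩
    obtain ⟨y, hy, hxy⟩ := exists_dist_spikeEmbedding_le hc hc' hθ h hT hT'
      (mem_closedBall_zero_iff.1 hx)
    exact ⟨_, ⟨y, mem_closedBall_zero_iff.2 hy, rfl⟩, by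
      rw [edist_dist]; exact ENNReal.ofReal_le_ofReal hxy⟩
  · rintro _ ⟨y, hy, rfl⟩
    obtain ⟨x, hx, hxy⟩ := exists_dist_spikeEmbedding_le hc' hc hθ (fun n m hnm => by
      rw [abs_sub_comm]; exact h n m hnm) hT' hT (mem_closedBall_zero_iff.1 hy)
    exact ⟨_, ⟨x, mem_closedBall_zero_iff.2 hx, rfl⟩, by
      rw [edist_dist]; exact ENNReal.ofReal_le_ofReal hxy⟩

theorem IsNearIsometry.transfer {T : X ≃ₗ[ℝ] Ell2} (hT : ∀ x, spikeNorm c (T x) = ‖x‖)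
    {T' : Y ≃ₗ[ℝ] Ell2} (hT' : ∀ y, spikeNorm c' (T' y) = ‖y‖) {ε : ℝ} {R : X → Y → Prop}
    (hR : IsNearIsometry (fun x => ‖x‖) (fun y => ‖y‖) ε R) :
    IsNearIsometry (spikeNorm c) (spikeNorm c') ε fun u v => R (T.symm u) (T'.symm v) := by
  have e : ∀ u, spikeNorm c u = ‖T.symm u‖ := fun u => by rw [← hT, T.apply_symm_apply]
  have e' : ∀ v, spikeNorm c' v = ‖T'.symm v‖ := fun v => by rw [← hT', T'.apply_symm_apply]
  refine ⟨fun u hu => ?_, fun v hv => ?_, fun u v h => ?_, fun u v h => ?_,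
    fun u v u' v' h h' => ?_⟩
  · obtain ⟨y, hy⟩ := hR.exists_right (T.symm u) (by rwa [e] at hu)
    exact ⟨T' y, by rwa [T'.symm_apply_apply]⟩
  · obtain ⟨x, hx⟩ := hR.exists_left (T'.symm v) (by rwa [e'] at hv)
    exact ⟨T x, by rwa [T.symm_apply_apply]⟩
  · rw [e]; exact hR.left_le _ _ h
  · rw [e']; exact hR.right_le _ _ h
  · rw [e, e', map_sub, map_sub]; exact hR.abs_sub_le _ _ _ _ h h'

end Model

/-! ### The Gromov–Hausdorff distance of uniformly discrete spaces -/

theorem ghDistance_le_of_equiv {M N : Type} [MetricSpace M] [MetricSpace N] [Nonempty M]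
    (e : M ≃ N) {η : ℝ} (hη : 0 < η) (h : ∀ p q, |dist p q - dist (e p) (e q)| ≤ 2 * η) :
    ghDistance M N ≤ ENNReal.ofReal η := by
  let _ : MetricSpace (M ⊕ N) := Metric.glueMetricApprox (id : M → M) e η hη h
  have hglue : ∀ p, dist (Sum.inl p : M ⊕ N) (Sum.inr (e p)) = η := fun p =>
    Metric.glueDist_glued_points (id : M → M) e η p
  refine iInf_le_of_le (M ⊕ N) (iInf_le_of_le inferInstance (iInf_le_of_le Sum.inl
    (iInf_le_of_le (Isometry.of_dist_eq fun _ _ => rfl) (iInf_le_of_le Sum.inr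
      (iInf_le_of_le (Isometry.of_dist_eq fun _ _ => rfl) ?_)))))
  refine Metric.hausdorffEDist_le_of_mem_edist ?_ ?_
  · rintro _ ⟨p, rfl⟩
    exact ⟨_, ⟨e p, rfl⟩, by rw [edist_dist, hglue]⟩
  · rintro _ ⟨q, rfl⟩
    refine ⟨_, ⟨e.symm q, rfl⟩, ?_⟩
    have := hglue (e.symm q)
    rw [e.apply_symm_apply] at this
    rw [edist_dist, dist_comm, this]

/-- Two spaces whose distinct points have distance at least `1 / 2` and which are close in the
Gromov–Hausdorff distance admit an almost isometric bijection. -/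
theorem exists_equiv_of_ghDistance_lt {M N : Type} [MetricSpace M] [MetricSpace N] {ε : ℝ}
    (hε : ε ≤ 1 / 8) (hM : ∀ p q : M, p ≠ q → 1 / 2 ≤ dist p q)
    (hN : ∀ p q : N, p ≠ q → 1 / 2 ≤ dist p q) (h : ghDistance M N < ENNReal.ofReal ε) :
    ∃ e : M ≃ N, ∀ p q, |dist p q - dist (e p) (e q)| ≤ 2 * ε := by
  simp only [ghDistance, iInf_lt_iff] at h
  obtain ⟨Z, _, i, hi, j, hj, h⟩ := h
  have hd : ∀ {z w : Z}, edist z w < ENNReal.ofReal ε → dist z w < ε := by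
    intro z w hzw
    rw [edist_dist] at hzw
    exact (ENNReal.ofReal_lt_ofReal_iff_of_nonneg dist_nonneg).1 hzw
  have h1 : ∀ p, ∃ q, dist (i p) (j q) < ε := by
    intro p
    obtain ⟨_, ⟨q, rfl⟩, hpq⟩ := Metric.exists_edist_lt_of_hausdorffEDist_lt (mem_range_self p) h
    exact ⟨q, hd hpq⟩
  have h2 : ∀ q, ∃ p, dist (i p) (j q) < ε := by
    intro q
    rw [Metric.hausdorffEDist_comm] at h
    obtain ⟨_, ⟨p, rfl⟩, hpq⟩ := Metric.exists_edist_lt_of_hausdorffEDist_lt (mem_range_self q) h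
    exact ⟨p, by rw [dist_comm]; exact hd hpq⟩
  choose a ha using h1
  choose b hb using h2
  have hab : ∀ q, a (b q) = q := by
    intro q
    by_contra hne
    have h3 := hN _ _ hne
    rw [← hj.dist_eq] at h3
    have h4 := dist_triangle_left (j (a (b q))) (j q) (i (b q))
    linarith [ha (b q), hb q]
  have hba : ∀ p, b (a p) = p := by
    intro p
    by_contra hne
    have h3 := hM _ _ hne
    rw [← hi.dist_eq] at h3
    have h4 := dist_triangle_right (i (b (a p))) (i p) (j (a p))
    linarith [ha p, hb (a p)]
  refine ⟨⟨a, b, hba, hab⟩, fun p q => ?_⟩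
  change |dist p q - dist (a p) (a q)| ≤ 2 * ε
  rw [← hi.dist_eq, ← hj.dist_eq, abs_le]
  have h3 := dist_triangle4 (i p) (j (a p)) (j (a q)) (i q)
  have h4 := dist_triangle4 (j (a p)) (i p) (i q) (j (a q))
  rw [dist_comm (j (a q)) (i q)] at h3
  rw [dist_comm (j (a p)) (i p)] at h4
  constructor <;> linarith [ha p, ha q]

/-! ### Coding the spiked norms -/

/-- The inclusion of the finitely supported real sequences into `ℓ₂`. -/
def finsuppToEll2 : (ℕ →₀ ℝ) →ₗ[ℝ] Ell2 where
  toFun x := ⟨fun n => x n, (memℓp_zero (x.hasFiniteSupport.subset fun n hn => by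
    simpa using hn)).of_exponent_ge zero_le⟩
  map_add' _ _ := rfl
  map_smul' _ _ := rfl

theorem finsuppToEll2_apply (x : ℕ →₀ ℝ) (n : ℕ) : finsuppToEll2 x n = x n := rfl

theorem finsuppToEll2_injective : Function.Injective finsuppToEll2 := fun _ _ h =>
  Finsupp.ext fun n => congrArg (fun z : Ell2 => z n) h

theorem denseRange_finsuppToEll2 : DenseRange finsuppToEll2 := by
  intro x
  refine mem_closure_of_tendsto (lp.hasSum_single (by norm_num) x)
    (Filter.Eventually.of_forall fun s => ?_)
  refine ⟨∑ i ∈ s, Finsupp.single i (x i), ?_⟩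
  rw [map_sum]
  refine Finset.sum_congr rfl fun i _ => ?_
  ext n
  rw [finsuppToEll2_apply, lp.single_apply, Finsupp.single_apply, Pi.single_apply]
  simp only [eq_comm]

theorem toEll2_add (v w : ℕ →₀ ℚ) : toEll2 (v + w) = toEll2 v + toEll2 w := by
  ext n
  change ((v + w) n : ℝ) = (v n : ℝ) + (w n : ℝ)
  rw [Finsupp.add_apply, Rat.cast_add]

theorem toEll2_smul (q : ℚ) (v : ℕ →₀ ℚ) : toEll2 (q • v) = (q : ℝ) • toEll2 v := by
  ext n
  change ((q • v) n : ℝ) = (q : ℝ) * (v n : ℝ)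
  rw [Finsupp.smul_apply, smul_eq_mul, Rat.cast_mul]

theorem toEll2_eq_zero_iff (v : ℕ →₀ ℚ) : toEll2 v = 0 ↔ v = 0 := by
  refine ⟨fun h => Finsupp.ext fun n => ?_, fun h => ?_⟩
  · have : (v n : ℝ) = 0 := congrArg (fun z : Ell2 => z n) h
    exact_mod_cast this
  · ext n
    rw [h]
    exact Rat.cast_zero

theorem toEll2_pair {n m : ℕ} (h : n ≠ m) :
    toEll2 (Finsupp.single n 1 + Finsupp.single m 1) = √2 • axis n m := by
  ext i
  change (((Finsupp.single n 1 + Finsupp.single m 1 : ℕ →₀ ℚ) i : ℚ) : ℝ) = √2 * axis n m i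
  rw [axis_apply, ← mul_assoc, mul_one_div_cancel (by positivity), one_mul, Finsupp.add_apply,
    Finsupp.single_apply, Finsupp.single_apply]
  by_cases h1 : n = i
  · have h2 : m ≠ i := fun e => h (h1.trans e.symm)
    simp [h1, h2]
  · by_cases h2 : m = i
    · simp [h1, h2]
    · simp [h1, h2, Ne.symm h1, Ne.symm h2]

namespace IsSpikeWeight

variable {κ : ℝ} {c : ℕ → ℕ → ℝ}

theorem spikeNorm_nonneg (hc : IsSpikeWeight κ c) (x : Ell2) : 0 ≤ spikeNorm c x :=
  (norm_nonneg x).trans (hc.norm_le x)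

theorem spikeNorm_eq_zero_iff (hc : IsSpikeWeight κ c) (x : Ell2) : spikeNorm c x = 0 ↔ x = 0 := by
  refine ⟨fun h => norm_le_zero_iff.1 ((hc.norm_le x).trans h.le), fun h => ?_⟩
  refine le_antisymm ((hc.spikeNorm_le x).trans ?_) (hc.spikeNorm_nonneg x)
  rw [h, norm_zero, mul_zero]

theorem continuous_spikeNorm (hc : IsSpikeWeight κ c) : Continuous (spikeNorm c) := by
  refine (LipschitzWith.of_dist_le_mul (K := 2) fun x y => ?_).continuous
  rw [Real.dist_eq, dist_eq_norm]
  have h1 := hc.spikeNorm_add_le (x - y) y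
  have h2 := hc.spikeNorm_add_le (y - x) x
  rw [sub_add_cancel] at h1 h2
  have h3 := hc.spikeNorm_le (x - y)
  have h4 := hc.spikeNorm_le (y - x)
  rw [norm_sub_rev] at h4
  have h5 := norm_nonneg (x - y)
  rw [abs_le]
  push_cast
  constructor <;> linarith

/-- On an axis the spiked norm is the weight of that axis. -/
theorem spikeNorm_axis (hc : IsSpikeWeight κ c) {n m : ℕ} (h : n ≠ m) :
    spikeNorm c (axis n m) = c n m := by
  have h1 : 1 ≤ c n m := by linarith [hc.one_lt, hc.le n m h]
  refine le_antisymm (hc.spikeNorm_le_iff.2 ⟨by rw [norm_axis h]; exact h1, fun k l hkl => ?_⟩) ?_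
  · rw [inner_axis_axis, abs_of_nonneg (by positivity)]
    have h3 := hc.le_max k l hkl
    have h5 := hc.pos hkl
    have h2 : ({n, m} ∩ {k, l} : Finset ℕ).card ≤ 2 :=
      (Finset.card_le_card Finset.inter_subset_left).trans (Finset.card_pair h).le
    by_cases h4 : ({n, m} ∩ {k, l} : Finset ℕ).card = 2
    · rw [hc.congr (Finset.eq_of_card_inter_eq_two (Finset.card_pair h) (Finset.card_pair hkl) h4),
        h4]
      norm_num
    · have h6 : (({n, m} ∩ {k, l} : Finset ℕ).card : ℝ) ≤ 1 := by
        exact_mod_cast (by omega : ({n, m} ∩ {k, l} : Finset ℕ).card ≤ 1)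
      have h7 : c k l * ((({n, m} ∩ {k, l} : Finset ℕ).card : ℝ) / 2) ≤ c k l * (1 / 2) := by
        gcongr
      linarith
  · have := hc.inner_le h (axis n m)
    rwa [real_inner_self_eq_norm_sq, norm_axis h, one_pow, abs_one, mul_one] at this

/-- The spiked norm on the finitely supported sequences. -/
def finsuppSeminorm (hc : IsSpikeWeight κ c) : Seminorm ℝ (ℕ →₀ ℝ) :=
  Seminorm.of (fun x => spikeNorm c (finsuppToEll2 x))
    (fun x y => by rw [map_add]; exact hc.spikeNorm_add_le _ _)
    (fun a x => by rw [map_smul, hc.spikeNorm_smul, Real.norm_eq_abs])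

theorem isNormExtension (hc : IsSpikeWeight κ c) :
    IsNormExtension (fun v => spikeNorm c (toEll2 v)) hc.finsuppSeminorm := by
  refine ⟨fun x hx => ?_, fun v => rfl⟩
  have h : finsuppToEll2 x = 0 := (hc.spikeNorm_eq_zero_iff _).1 hx
  exact finsuppToEll2_injective (by rw [h, map_zero])

theorem mem_banachCodes (hc : IsSpikeWeight κ c) :
    (fun v => spikeNorm c (toEll2 v)) ∈ banachCodes := by
  refine ⟨fun v => ?_, fun q v => ?_, fun v w => ?_, _, hc.isNormExtension⟩
  · rw [hc.spikeNorm_eq_zero_iff, toEll2_eq_zero_iff]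
  · beta_reduce
    rw [toEll2_smul, hc.spikeNorm_smul]
  · beta_reduce
    rw [toEll2_add]
    exact hc.spikeNorm_add_le _ _

/-- The Banach space coded by the restriction of a spiked norm is `ℓ₂` with this norm. -/
theorem exists_linearEquiv (hc : IsSpikeWeight κ c) {ν : banachCodes}
    (hν : ∀ v, ν.1 v = spikeNorm c (toEll2 v)) :
    ∃ T : CodedBanachSpace ν ≃ₗ[ℝ] Ell2, ∀ x, spikeNorm c (T x) = ‖x‖ := by
  have hN : extendedNorm ν = hc.finsuppSeminorm :=
    (extendedNorm_spec ν).unique ⟨hc.isNormExtension.1, fun v => (hν v).symm⟩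
  let e₂ : CodedNormedSpace ν →ₗ[ℝ] Ell2 := finsuppToEll2
  let e₁ : CodedNormedSpace ν →ₗ[ℝ] CodedBanachSpace ν :=
    (UniformSpace.Completion.toComplₗᵢ (𝕜 := ℝ) (E := CodedNormedSpace ν)).toLinearMap
  have he₁ : ∀ x, ‖e₁ x‖ = ‖x‖ := fun x => UniformSpace.Completion.norm_coe x
  have hnorm : ∀ x : CodedNormedSpace ν, ‖x‖ = spikeNorm c (e₂ x) := fun x =>
    congrArg (fun N : Seminorm ℝ (ℕ →₀ ℝ) => N x) hN
  have hd₁ : DenseRange e₁ := UniformSpace.Completion.denseRange_coe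
  have hd₂ : DenseRange e₂ := denseRange_finsuppToEll2
  have h₁ : ∃ C, ∀ x, ‖e₂ (LinearEquiv.refl ℝ (CodedNormedSpace ν) x)‖ ≤ C * ‖e₁ x‖ :=
    ⟨1, fun x => by rw [he₁, hnorm, one_mul]; exact hc.norm_le _⟩
  have h₂ : ∃ C, ∀ x, ‖e₁ ((LinearEquiv.refl ℝ (CodedNormedSpace ν)).symm x)‖ ≤ C * ‖e₂ x‖ :=
    ⟨200 / 199, fun x => by rw [he₁, hnorm]; exact hc.spikeNorm_le _⟩
  let T := (LinearEquiv.refl ℝ (CodedNormedSpace ν)).extend e₁ e₂ hd₁ h₁ hd₂ h₂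
  refine ⟨T.toLinearEquiv, fun x => ?_⟩
  refine hd₁.induction_on (p := fun x => spikeNorm c (T x) = ‖x‖) x
    (isClosed_eq (hc.continuous_spikeNorm.comp T.continuous) continuous_norm) fun x => ?_
  rw [LinearEquiv.extend_eq, LinearEquiv.refl_apply, he₁, hnorm]

end IsSpikeWeight

/-! ### Criteria for reductions -/

theorem le_ofReal_mul_of_linear {a b : ℝ≥0∞} {C t₀ B : ℝ} (hC : 0 < C) (ht₀ : 0 < t₀)
    (h : ∀ t, 0 < t → t ≤ t₀ → b < ENNReal.ofReal t → a ≤ ENNReal.ofReal (C * t)) (hB : 0 ≤ B)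
    (haB : a ≤ ENNReal.ofReal B) : a ≤ ENNReal.ofReal (max C (B / t₀)) * b := by
  rcases lt_or_ge b (ENNReal.ofReal t₀) with hb | hb
  · obtain ⟨r, hr, rfl⟩ : ∃ r : ℝ, 0 ≤ r ∧ b = ENNReal.ofReal r :=
      ⟨b.toReal, ENNReal.toReal_nonneg, (ENNReal.ofReal_toReal hb.ne_top).symm⟩
    obtain ⟨q, hq, rfl⟩ : ∃ q : ℝ, 0 ≤ q ∧ a = ENNReal.ofReal q :=
      ⟨a.toReal, ENNReal.toReal_nonneg, (ENNReal.ofReal_toReal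
        (haB.trans_lt ENNReal.ofReal_lt_top).ne).symm⟩
    have hrt : r < t₀ := (ENNReal.ofReal_lt_ofReal_iff ht₀).1 hb
    have hqr : q ≤ C * r := by
      by_contra! hcon
      have h1 : r < q / C := by rwa [lt_div_iff₀ hC, mul_comm]
      obtain ⟨s, hs1, hs2⟩ := exists_between (lt_min h1 hrt)
      have hs0 : 0 < s := hr.trans_lt hs1
      have h2 := h s hs0 (hs2.le.trans (min_le_right _ _))
        ((ENNReal.ofReal_lt_ofReal_iff hs0).2 hs1)
      have h3 := (ENNReal.ofReal_le_ofReal_iff (by positivity)).1 h2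
      have h4 : s < q / C := hs2.trans_le (min_le_left _ _)
      rw [lt_div_iff₀ hC, mul_comm] at h4
      linarith
    rw [← ENNReal.ofReal_mul (hC.le.trans (le_max_left _ _))]
    exact ENNReal.ofReal_le_ofReal (hqr.trans (by gcongr; exact le_max_left _ _))
  · calc a ≤ ENNReal.ofReal (B / t₀) * ENNReal.ofReal t₀ := by
          rw [← ENNReal.ofReal_mul (by positivity), div_mul_cancel₀ _ ht₀.ne']
          exact haB
      _ ≤ _ := by
          gcongr
          exact le_max_right _ _

section Reductions

variable {P Q : Type} [MeasurableSpace P] [MeasurableSpace Q] {ρP : P → P → ℝ≥0∞}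
  {ρQ : Q → Q → ℝ≥0∞} {F : P → Q}

/-- Linear estimates for small distances suffice for a uniformly continuous reduction. -/
theorem isBorelUniformReduction_of_linear (hF : Measurable F) {C t₀ C' t₀' : ℝ} (hC : 0 < C)
    (ht₀ : 0 < t₀) (hC' : 0 < C') (ht₀' : 0 < t₀')
    (h : ∀ x y t, 0 < t → t ≤ t₀ → ρP x y < ENNReal.ofReal t →
      ρQ (F x) (F y) ≤ ENNReal.ofReal (C * t))
    (h' : ∀ x y t, 0 < t → t ≤ t₀' → ρQ (F x) (F y) < ENNReal.ofReal t →
      ρP x y ≤ ENNReal.ofReal (C' * t)) :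
    IsBorelUniformReduction ρP ρQ F := by
  refine ⟨hF, fun ε hε => ?_⟩
  have key : ∀ {K s : ℝ}, 0 < K → K * min s (ε / (2 * K)) < ε := by
    intro K s hK
    calc K * min s (ε / (2 * K)) ≤ K * (ε / (2 * K)) := by gcongr; exact min_le_right _ _
      _ = ε / 2 := by field_simp
      _ < ε := by linarith
  refine ⟨min t₀ (ε / (2 * C)), by positivity, min t₀' (ε / (2 * C')), by positivity,
    fun x y hxy => ?_, fun x y hxy => ?_⟩
  · exact (h x y _ (by positivity) (min_le_left _ _) hxy).trans_lt
      ((ENNReal.ofReal_lt_ofReal_iff hε).2 (key hC))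
  · exact (h' x y _ (by positivity) (min_le_left _ _) hxy).trans_lt
      ((ENNReal.ofReal_lt_ofReal_iff hε).2 (key hC'))

/-- Linear estimates for small distances suffice for a Lipschitz reduction if both distances are
bounded. -/
theorem isBorelLipschitzReduction_of_linear (hF : Measurable F) {C t₀ C' t₀' B B' : ℝ} (hC : 0 < C)
    (ht₀ : 0 < t₀) (hC' : 0 < C') (ht₀' : 0 < t₀') (hB : 0 ≤ B) (hB' : 0 ≤ B')
    (h : ∀ x y t, 0 < t → t ≤ t₀ → ρP x y < ENNReal.ofReal t →
      ρQ (F x) (F y) ≤ ENNReal.ofReal (C * t))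
    (h' : ∀ x y t, 0 < t → t ≤ t₀' → ρQ (F x) (F y) < ENNReal.ofReal t →
      ρP x y ≤ ENNReal.ofReal (C' * t))
    (hbd : ∀ x y, ρQ (F x) (F y) ≤ ENNReal.ofReal B) (hbd' : ∀ x y, ρP x y ≤ ENNReal.ofReal B') :
    IsBorelLipschitzReduction ρP ρQ F := by
  refine ⟨hF, max (max C (B / t₀)) (max C' (B' / t₀')), by positivity, fun x y => ⟨?_, ?_⟩⟩
  · refine (le_ofReal_mul_of_linear hC ht₀ (h x y) hB (hbd x y)).trans ?_
    exact mul_le_mul' (ENNReal.ofReal_le_ofReal (le_max_left _ _)) le_rfl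
  · refine (le_ofReal_mul_of_linear hC' ht₀' (h' x y) hB' (hbd' x y)).trans ?_
    exact mul_le_mul' (ENNReal.ofReal_le_ofReal (le_max_right _ _)) le_rfl

end Reductions

/-! ### Metrics on `ℕ` as weights -/

section MetricWeights

variable {α δ : ℝ}

theorem dist_mem_Icc (f : boundedMetricCodes (1 / 2) 1) {n m : ℕ} (h : n ≠ m) :
    f.1 n m ∈ Icc (1 / 2 : ℝ) 1 :=
  (f.2.2 n m).resolve_left fun h0 => h ((f.2.1.1 n m).1 h0)

theorem isSpikeWeight (hα : 1 < α) (hδ : α < α + δ) (hαδ : α + δ ≤ 200 / 199)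
    (f : boundedMetricCodes (1 / 2) 1) : IsSpikeWeight α (fun n m => α + δ * f.1 n m) where
  one_lt := hα
  symm n m := by rw [f.2.1.2.1 n m]
  le n m h := by
    have := (dist_mem_Icc f h).1
    nlinarith
  le_max n m h := by
    have := (dist_mem_Icc f h).2
    nlinarith

theorem renorm_eq_spikeNorm (α δ : ℝ) (f : ℕ → ℕ → ℝ) :
    renorm α δ f = spikeNorm (fun n m => α + δ * f n m) := rfl

theorem measurable_renorm (hα : 1 < α) (hδ : α < α + δ) (hαδ : α + δ ≤ 200 / 199) (x : Ell2) :
    Measurable fun f : boundedMetricCodes (1 / 2) 1 => renorm α δ f.1 x := by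
  refine measurable_of_Iic fun B => ?_
  have h : (fun f : boundedMetricCodes (1 / 2) 1 => renorm α δ f.1 x) ⁻¹' Iic B =
      {_f | ‖x‖ ≤ B} ∩ ⋂ (n : ℕ) (m : ℕ) (_ : n ≠ m),
        {f | (α + δ * f.1 n m) * |inner ℝ x (axis n m)| ≤ B} := by
    ext f
    simp only [mem_preimage, mem_Iic, renorm_eq_spikeNorm,
      (isSpikeWeight hα hδ hαδ f).spikeNorm_le_iff, mem_inter_iff, mem_ofPred_eq, mem_iInter]
  rw [h]
  refine (MeasurableSet.const _).inter (MeasurableSet.iInter fun n => MeasurableSet.iInter fun m =>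
    MeasurableSet.iInter fun _ => measurableSet_le ?_ measurable_const)
  have : Measurable fun f : boundedMetricCodes (1 / 2) 1 => f.1 n m :=
    (measurable_pi_apply m).comp ((measurable_pi_apply n).comp measurable_subtype_coe)
  exact (measurable_const.add (measurable_const.mul this)).mul measurable_const

theorem rhoGH_le_of_perm {f g : boundedMetricCodes (1 / 2) 1} (π : Equiv.Perm ℕ) {η : ℝ}
    (hη : 0 < η) (h : ∀ n m, n ≠ m → |f.1 n m - g.1 (π n) (π m)| ≤ 2 * η) :
    rhoGH (1 / 2) 1 f g ≤ ENNReal.ofReal η := by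
  have : Nonempty (CodedMetricSpace ⟨f.1, f.2.1⟩) := ⟨(0 : ℕ)⟩
  refine ghDistance_le_of_equiv (M := CodedMetricSpace ⟨f.1, f.2.1⟩)
    (N := CodedMetricSpace ⟨g.1, g.2.1⟩) π hη fun n m => ?_
  rcases eq_or_ne n m with rfl | hnm
  · rw [dist_self, dist_self, sub_zero, abs_zero]; positivity
  · exact h n m hnm

theorem exists_perm_of_rhoGH_lt {f g : boundedMetricCodes (1 / 2) 1} {ε : ℝ} (hε : ε ≤ 1 / 8)
    (h : rhoGH (1 / 2) 1 f g < ENNReal.ofReal ε) :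
    ∃ π : Equiv.Perm ℕ, ∀ n m, |f.1 n m - g.1 (π n) (π m)| ≤ 2 * ε :=
  exists_equiv_of_ghDistance_lt (M := CodedMetricSpace ⟨f.1, f.2.1⟩)
    (N := CodedMetricSpace ⟨g.1, g.2.1⟩) hε (fun _ _ hne => (dist_mem_Icc f hne).1)
    (fun _ _ hne => (dist_mem_Icc g hne).1) h

theorem abs_dist_sub_dist_le_one (f g : boundedMetricCodes (1 / 2) 1) {n m k l : ℕ} (h : n ≠ m)
    (h' : k ≠ l) : |f.1 n m - g.1 k l| ≤ 1 := by
  have h1 := dist_mem_Icc f h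
  have h2 := dist_mem_Icc g h'
  rw [abs_le]
  constructor <;> linarith [h1.1, h1.2, h2.1, h2.2]

theorem rhoGH_le_one (f g : boundedMetricCodes (1 / 2) 1) :
    rhoGH (1 / 2) 1 f g ≤ ENNReal.ofReal 1 :=
  rhoGH_le_of_perm (Equiv.refl ℕ) one_pos fun n m h =>
    (abs_dist_sub_dist_le_one f g h h).trans (by norm_num)

variable {X Y : Type} [NormedAddCommGroup X] [NormedSpace ℝ X]
  [NormedAddCommGroup Y] [NormedSpace ℝ Y] {f g : boundedMetricCodes (1 / 2) 1}

/-- A near-isometry between the unit balls of the renormed spaces bounds the Gromov–Hausdorff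
distance of the metrics. -/
theorem rhoGH_le_of_isNearIsometry (hα : 1 < α) (hδ : α < α + δ) (hαδ : α + δ ≤ 200 / 199)
    {T : X ≃ₗ[ℝ] Ell2} (hT : ∀ x, renorm α δ f.1 (T x) = ‖x‖)
    {T' : Y ≃ₗ[ℝ] Ell2} (hT' : ∀ y, renorm α δ g.1 (T' y) = ‖y‖) {ε : ℝ} (hε : 0 < ε)
    (hεα : ε ≤ (α - 1) / 100)
    (hR : ∃ R : X → Y → Prop, IsNearIsometry (fun x => ‖x‖) (fun y => ‖y‖) ε R) :
    rhoGH (1 / 2) 1 f g ≤ ENNReal.ofReal (4 / δ * ε) := by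
  obtain ⟨R, hR⟩ := hR
  have hδ' : 0 < δ := by linarith
  obtain ⟨π, hπ⟩ := (hR.transfer hT hT').exists_perm (isSpikeWeight hα hδ hαδ f)
    (isSpikeWeight hα hδ hαδ g) hε hεα
  refine rhoGH_le_of_perm π (by positivity) fun n m h => ?_
  have h1 := hπ n m h
  have h2 : α + δ * f.1 n m - (α + δ * g.1 (π n) (π m)) =
      δ * (f.1 n m - g.1 (π n) (π m)) := by ring
  rw [h2, abs_mul, abs_of_pos hδ'] at h1
  calc |f.1 n m - g.1 (π n) (π m)| = δ * |f.1 n m - g.1 (π n) (π m)| / δ := by field_simp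
    _ ≤ 8 * ε / δ := by gcongr
    _ = _ := by ring

/-- If two metrics nearly agree up to a permutation of `ℕ`, then the renormed spaces are spiked
norms on `ℓ₂` with nearby weights. -/
theorem exists_weights_of_perm (hα : 1 < α) (hδ : α < α + δ) (hαδ : α + δ ≤ 200 / 199)
    {T' : Y ≃ₗ[ℝ] Ell2} (hT' : ∀ y, renorm α δ g.1 (T' y) = ‖y‖) (π : Equiv.Perm ℕ) {η : ℝ}
    (h : ∀ n m, n ≠ m → |f.1 n m - g.1 (π n) (π m)| ≤ η) :
    ∃ c' : ℕ → ℕ → ℝ, IsSpikeWeight α c' ∧ (∀ n m, n ≠ m →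
      |(α + δ * f.1 n m) - c' n m| ≤ δ * η) ∧
      ∃ S : Y ≃ₗ[ℝ] Ell2, ∀ y, spikeNorm c' (S y) = ‖y‖ := by
  have hg := isSpikeWeight hα hδ hαδ g
  have hδ' : 0 < δ := by linarith
  refine ⟨_, hg.perm π, fun n m hnm => ?_, T'.trans (permL2 π).toLinearEquiv, fun y => ?_⟩
  · have h2 : α + δ * f.1 n m - (α + δ * g.1 (π n) (π m)) =
        δ * (f.1 n m - g.1 (π n) (π m)) := by ring
    rw [h2, abs_mul, abs_of_pos hδ']
    exact mul_le_mul_of_nonneg_left (h n m hnm) hδ'.le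
  · rw [← hT' y]
    exact hg.spikeNorm_permL2 π (T' y)

theorem kadetsDistance_le_of_perm (hα : 1 < α) (hδ : α < α + δ) (hαδ : α + δ ≤ 200 / 199)
    {T : X ≃ₗ[ℝ] Ell2} (hT : ∀ x, renorm α δ f.1 (T x) = ‖x‖)
    {T' : Y ≃ₗ[ℝ] Ell2} (hT' : ∀ y, renorm α δ g.1 (T' y) = ‖y‖) (π : Equiv.Perm ℕ) {η : ℝ}
    (hη : 0 ≤ η) (h : ∀ n m, n ≠ m → |f.1 n m - g.1 (π n) (π m)| ≤ η) :
    kadetsDistance X Y ≤ ENNReal.ofReal (2 * (δ * η)) := by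
  obtain ⟨c', hc', hcc, S, hS⟩ := exists_weights_of_perm hα hδ hαδ hT' π h
  exact kadetsDistance_le (isSpikeWeight hα hδ hαδ f) hc' (mul_nonneg (by linarith) hη) hcc hT hS

theorem exists_continuousLinearEquiv_of_perm (hα : 1 < α) (hδ : α < α + δ)
    (hαδ : α + δ ≤ 200 / 199)
    {T : X ≃ₗ[ℝ] Ell2} (hT : ∀ x, renorm α δ f.1 (T x) = ‖x‖)
    {T' : Y ≃ₗ[ℝ] Ell2} (hT' : ∀ y, renorm α δ g.1 (T' y) = ‖y‖) (π : Equiv.Perm ℕ) {η : ℝ}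
    (hη : 0 ≤ η) (h : ∀ n m, n ≠ m → |f.1 n m - g.1 (π n) (π m)| ≤ η) :
    ∃ A : X ≃L[ℝ] Y, (∀ x, ‖A x‖ ≤ (1 + δ * η) * ‖x‖) ∧
      ∀ y, ‖A.symm y‖ ≤ (1 + δ * η) * ‖y‖ := by
  obtain ⟨c', hc', hcc, S, hS⟩ := exists_weights_of_perm hα hδ hαδ hT' π h
  exact exists_continuousLinearEquiv (isSpikeWeight hα hδ hαδ f) hc'
    (mul_nonneg (by linarith) hη) hcc hT hS

end MetricWeights

end

theorem mainTheorem2 (α δ : ℝ) (hα : 1 < α) (hδ : α < α + δ) (hαδ : α + δ ≤ 200 / 199) :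
    ∃ Φ : boundedMetricCodes (1 / 2) 1 → banachCodes,
      -- the code of `f` is the restriction of the equivalent norm `‖·‖_f`
      (∀ f v, (Φ f).1 v = renorm α δ f.1 (toEll2 v)) ∧
      (∀ (f : boundedMetricCodes (1 / 2) 1) (x : Ell2),
        ‖x‖ ≤ renorm α δ f.1 x ∧ renorm α δ f.1 x ≤ 200 / 199 * ‖x‖) ∧
      -- the coded space is isometric to `(ℓ₂, ‖·‖_f)`
      (∀ f, ∃ T : CodedBanachSpace (Φ f) ≃ₗ[ℝ] Ell2, ∀ x, renorm α δ f.1 (T x) = ‖x‖) ∧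
      Function.Injective Φ ∧
      IsBorelUniformReduction (rhoGH (1 / 2) 1) rhoK Φ ∧
      IsBorelUniformReduction (rhoGH (1 / 2) 1) rhoBM Φ ∧
      IsBorelUniformReduction (rhoGH (1 / 2) 1) rhoL Φ ∧
      IsBorelUniformReduction (rhoGH (1 / 2) 1) rhoU Φ ∧
      IsBorelUniformReduction (rhoGH (1 / 2) 1) rhoN Φ ∧
      IsBorelUniformReduction (rhoGH (1 / 2) 1) rhoGHB Φ ∧
      IsBorelLipschitzReduction (rhoGH (1 / 2) 1) rhoK Φ ∧
      IsBorelLipschitzReduction (rhoGH (1 / 2) 1) rhoBM Φ := by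
  have hw := isSpikeWeight hα hδ hαδ
  have hδ' : 0 < δ := by linarith
  let Φ : boundedMetricCodes (1 / 2) 1 → banachCodes := fun f =>
    ⟨fun v => renorm α δ f.1 (toEll2 v), (hw f).mem_banachCodes⟩
  have hiso : ∀ f, ∃ T : CodedBanachSpace (Φ f) ≃ₗ[ℝ] Ell2, ∀ x, renorm α δ f.1 (T x) = ‖x‖ :=
    fun f => (hw f).exists_linearEquiv fun _ => rfl
  have hmeas : Measurable Φ := Measurable.subtype_mk
    (measurable_pi_lambda _ fun v => measurable_renorm hα hδ hαδ (toEll2 v))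
  choose T hT using hiso
  have hnt : ∀ f, Nontrivial (CodedBanachSpace (Φ f)) := fun f => by
    have : Nontrivial Ell2 := ⟨axis 0 1, 0, fun h => by
      have := norm_axis (n := 0) (m := 1) (by norm_num)
      rw [h, norm_zero] at this
      exact zero_ne_one this⟩
    exact (T f).toEquiv.nontrivial
  -- Upper estimates for the distances between the coded spaces.
  have upK : ∀ f g t, 0 < t → t ≤ 1 / 8 → rhoGH (1 / 2) 1 f g < ENNReal.ofReal t →
      rhoK (Φ f) (Φ g) ≤ ENNReal.ofReal (4 * δ * t) := by
    intro f g t ht ht' h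
    obtain ⟨π, hπ⟩ := exists_perm_of_rhoGH_lt ht' h
    refine (kadetsDistance_le_of_perm hα hδ hαδ (hT f) (hT g) π (η := 2 * t) (by positivity)
      fun n m _ => hπ n m).trans (ENNReal.ofReal_le_ofReal (by linarith))
  have upA : ∀ f g t, 0 < t → t ≤ 1 / 8 → rhoGH (1 / 2) 1 f g < ENNReal.ofReal t →
      ∃ A : CodedBanachSpace (Φ f) ≃L[ℝ] CodedBanachSpace (Φ g),
        (∀ x, ‖A x‖ ≤ (1 + δ * (2 * t)) * ‖x‖) ∧
          ∀ y, ‖A.symm y‖ ≤ (1 + δ * (2 * t)) * ‖y‖ := by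
    intro f g t ht ht' h
    obtain ⟨π, hπ⟩ := exists_perm_of_rhoGH_lt ht' h
    exact exists_continuousLinearEquiv_of_perm hα hδ hαδ (hT f) (hT g) π (by positivity)
      fun n m _ => hπ n m
  have upBM : ∀ f g t, 0 < t → t ≤ 1 / 8 → rhoGH (1 / 2) 1 f g < ENNReal.ofReal t →
      rhoBM (Φ f) (Φ g) ≤ ENNReal.ofReal (4 * δ * t) := by
    intro f g t ht ht' h
    obtain ⟨A, h1, h2⟩ := upA f g t ht ht' h
    exact (banachMazurDistance_le (by positivity) A h1 h2).trans
      (ENNReal.ofReal_le_ofReal (by linarith))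
  have upU : ∀ f g t, 0 < t → t ≤ 1 / 8 → rhoGH (1 / 2) 1 f g < ENNReal.ofReal t →
      rhoU (Φ f) (Φ g) ≤ ENNReal.ofReal (4 * δ * t) := by
    intro f g t ht ht' h
    obtain ⟨A, h1, h2⟩ := upA f g t ht ht' h
    exact (uniformDistance_le (by positivity) A h1 h2).trans
      (ENNReal.ofReal_le_ofReal (by linarith))
  have upL : ∀ f g t, 0 < t → t ≤ 1 / 8 → rhoGH (1 / 2) 1 f g < ENNReal.ofReal t →
      rhoL (Φ f) (Φ g) ≤ ENNReal.ofReal (2 * δ * t) := by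
    intro f g t ht ht' h
    obtain ⟨A, h1, h2⟩ := upA f g t ht ht' h
    exact (lipschitzDistance_le A h1 h2).trans (ENNReal.ofReal_le_ofReal (by linarith))
  have hNL : ∀ f g, rhoN (Φ f) (Φ g) ≤ rhoL (Φ f) (Φ g) := fun f g =>
    netDistance_le_lipschitzDistance _ _
  have hGK : ∀ f g, rhoGHB (Φ f) (Φ g) ≤ rhoK (Φ f) (Φ g) := fun f g =>
    ghBallDistance_le_kadetsDistance
  have bdK : ∀ f g, rhoK (Φ f) (Φ g) ≤ ENNReal.ofReal (2 * (δ * 1)) := fun f g =>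
    kadetsDistance_le_of_perm hα hδ hαδ (hT f) (hT g) (Equiv.refl ℕ) zero_le_one
      fun n m h => abs_dist_sub_dist_le_one f g h h
  have bdBM : ∀ f g, rhoBM (Φ f) (Φ g) ≤ ENNReal.ofReal (2 * (δ * 1)) := by
    intro f g
    obtain ⟨A, h1, h2⟩ := exists_continuousLinearEquiv_of_perm hα hδ hαδ (hT f) (hT g)
      (Equiv.refl ℕ) zero_le_one fun n m h => abs_dist_sub_dist_le_one f g h h
    exact banachMazurDistance_le (by positivity) A h1 h2
  -- Lower estimates: a small distance yields a near-isometry between the unit balls.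
  have hα' : 0 < (α - 1) / 1200 := by linarith
  have lowG : ∀ f g t, 0 < t → t ≤ (α - 1) / 1200 → rhoGHB (Φ f) (Φ g) < ENNReal.ofReal t →
      rhoGH (1 / 2) 1 f g ≤ ENNReal.ofReal (8 / δ * t) := fun f g t ht ht' h =>
    (rhoGH_le_of_isNearIsometry hα hδ hαδ (hT f) (hT g) (ε := 2 * t) (by positivity) (by linarith)
      (exists_isNearIsometry_of_ghBallDistance_lt h)).trans
      (ENNReal.ofReal_le_ofReal (le_of_eq (by ring)))
  have lowK : ∀ f g t, 0 < t → t ≤ (α - 1) / 1200 → rhoK (Φ f) (Φ g) < ENNReal.ofReal t →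
      rhoGH (1 / 2) 1 f g ≤ ENNReal.ofReal (8 / δ * t) := fun f g t ht ht' h =>
    lowG f g t ht ht' ((hGK f g).trans_lt h)
  have lowBM : ∀ f g t, 0 < t → t ≤ (α - 1) / 1200 → rhoBM (Φ f) (Φ g) < ENNReal.ofReal t →
      rhoGH (1 / 2) 1 f g ≤ ENNReal.ofReal (24 / δ * t) := by
    intro f g t ht ht' h
    have := hnt f
    exact (rhoGH_le_of_isNearIsometry hα hδ hαδ (hT f) (hT g) (ε := 6 * t) (by positivity)
      (by linarith) (exists_isNearIsometry_of_banachMazurDistance_lt ht (by linarith) h)).trans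
      (ENNReal.ofReal_le_ofReal (le_of_eq (by ring)))
  have lowU : ∀ f g t, 0 < t → t ≤ (α - 1) / 1200 → rhoU (Φ f) (Φ g) < ENNReal.ofReal t →
      rhoGH (1 / 2) 1 f g ≤ ENNReal.ofReal (24 / δ * t) := by
    intro f g t ht ht' h
    have := hnt f
    have := hnt g
    exact (rhoGH_le_of_isNearIsometry hα hδ hαδ (hT f) (hT g) (ε := 6 * t) (by positivity)
      (by linarith) (exists_isNearIsometry_of_uniformDistance_lt ht (by linarith) h)).trans
      (ENNReal.ofReal_le_ofReal (le_of_eq (by ring)))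
  have lowN : ∀ f g t, 0 < t → t ≤ (α - 1) / 1200 → rhoN (Φ f) (Φ g) < ENNReal.ofReal t →
      rhoGH (1 / 2) 1 f g ≤ ENNReal.ofReal (48 / δ * t) := fun f g t ht ht' h =>
    (rhoGH_le_of_isNearIsometry hα hδ hαδ (hT f) (hT g) (ε := 12 * t) (by positivity) (by linarith)
      (exists_isNearIsometry_of_netDistance_lt ht (by linarith) h)).trans
      (ENNReal.ofReal_le_ofReal (le_of_eq (by ring)))
  have lowL : ∀ f g t, 0 < t → t ≤ (α - 1) / 1200 → rhoL (Φ f) (Φ g) < ENNReal.ofReal t →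
      rhoGH (1 / 2) 1 f g ≤ ENNReal.ofReal (48 / δ * t) := fun f g t ht ht' h =>
    lowN f g t ht ht' ((hNL f g).trans_lt h)
  have h8 : (0 : ℝ) < 1 / 8 := by norm_num
  refine ⟨Φ, fun _ _ => rfl, fun f x => ⟨(hw f).norm_le x, (hw f).spikeNorm_le x⟩,
    fun f => ⟨T f, hT f⟩, fun f g hfg => ?_, ?_, ?_, ?_, ?_, ?_, ?_, ?_, ?_⟩
  · refine Subtype.ext (funext fun n => funext fun m => ?_)
    rcases eq_or_ne n m with rfl | h
    · rw [(f.2.1.1 n n).2 rfl, (g.2.1.1 n n).2 rfl]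
    · have h1 : renorm α δ f.1 (toEll2 (Finsupp.single n 1 + Finsupp.single m 1)) =
          renorm α δ g.1 (toEll2 (Finsupp.single n 1 + Finsupp.single m 1)) :=
        congrFun (congrArg Subtype.val hfg) _
      rw [toEll2_pair h, renorm_eq_spikeNorm, renorm_eq_spikeNorm, (hw f).spikeNorm_smul,
        (hw g).spikeNorm_smul, (hw f).spikeNorm_axis h, (hw g).spikeNorm_axis h] at h1
      have h2 := mul_left_cancel₀ (abs_pos.2 (by positivity : √2 ≠ 0)).ne' h1
      exact mul_left_cancel₀ hδ'.ne' (add_left_cancel h2)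
  · exact isBorelUniformReduction_of_linear hmeas (by positivity) h8 (by positivity) hα' upK lowK
  · exact isBorelUniformReduction_of_linear hmeas (by positivity) h8 (by positivity) hα' upBM lowBM
  · exact isBorelUniformReduction_of_linear hmeas (by positivity) h8 (by positivity) hα' upL lowL
  · exact isBorelUniformReduction_of_linear hmeas (by positivity) h8 (by positivity) hα' upU lowU
  · exact isBorelUniformReduction_of_linear hmeas (by positivity) h8 (by positivity) hα'
      (fun f g t ht ht' h => (hNL f g).trans (upL f g t ht ht' h)) lowN
  · exact isBorelUniformReduction_of_linear hmeas (by positivity) h8 (by positivity) hα'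
      (fun f g t ht ht' h => (hGK f g).trans (upK f g t ht ht' h)) lowG
  · exact isBorelLipschitzReduction_of_linear hmeas (by positivity) h8 (by positivity) hα'
      (by positivity) zero_le_one upK lowK bdK rhoGH_le_one
  · exact isBorelLipschitzReduction_of_linear hmeas (by positivity) h8 (by positivity) hα'
      (by positivity) zero_le_one upBM lowBM bdBM rhoGH_le_one
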